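/- Let $\mathcal{A}=\{A_1,\dots,A_m\}$ be a finite set of complex $d\times d$ matrices, let $\|\cdot\|$ be a norm on $\mathbb{C}^{d\times d}$, and for $n\ge 0$ put $$m_n(\mathcal{A})=\max_{1\le i_1,\dots,i_n\le m}\|A_{i_1}\cdots A_{i_n}\|$$ (a maximum over the empty set being $0$). Let $\langle\mathcal{A}\rangle$ be the multiplicative semigroup generated by $\mathcal{A}$, including the identity matrix as the empty product. Suppose that $\mathcal{A}$ is non-degenerate, that is, for every $M$ there is some $n\ge M$ with $m_n(\mathcal{A})\ne 0$ (this holds in particular if $m_n(\mathcal{A})\not\to 0$), and that $\langle\mathcal{A}\rangle$ is tame, that is, every eigenvalue of every matrix in $\langle\mathcal{A}\rangle$ is $0$ or a root of unity. Then there is a minimal nonnegative integer $k$ for which there exists a positive integer $a$ such that $$\prod_{i=1}^{k}(X_i^{2a}-X_i^{a})Y_i=0\qquad\text{for all } X_1,\dots,X_k,Y_1,\dots,Y_k\in\langle\mathcal{A}\rangle$$ (the product being taken in the order $i=1,\dots,k$, and the empty product being the identity matrix). This $k$ satisfies $k\ge 1$, and there exist positive constants $C_1$ and $C_2$ such that $$C_1n^{k-1}\le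 m_n(\mathcal{A})\le C_2n^{k-1}\qquad\text{for all } n\ge 1.$$ -/

import Mathlib

open Filter Topology

namespace MatrixGrowth

/-- The product `A (w 0) * A (w 1) * ⋯ * A (w (n - 1))`, in this order. -/
def wordProd {d m : ℕ} (A : Fin m → Matrix (Fin d) (Fin d) ℂ) {n : ℕ} (w : Fin n → Fin m) :
    Matrix (Fin d) (Fin d) ℂ :=
  (List.ofFn fun j : Fin n => A (w j)).prod

/-- `m_n(𝒜)`: the maximum of `‖A_{i_1} ⋯ A_{i_n}‖` over all words of length `n`. The supremum runs
over a finite set of nonnegative reals, hence is a maximum; it is `0` if there are no words. -/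
noncomputable def maxNorm {d m : ℕ} (N : Seminorm ℂ (Matrix (Fin d) (Fin d) ℂ))
    (A : Fin m → Matrix (Fin d) (Fin d) ℂ) (n : ℕ) : ℝ :=
  ⨆ w : Fin n → Fin m, N (wordProd A w)

/-- `𝒜` is non-degenerate: for every `M` there is some `n ≥ M` with `m_n(𝒜) ≠ 0`. -/
def NonDegenerate {d m : ℕ} (N : Seminorm ℂ (Matrix (Fin d) (Fin d) ℂ))
    (A : Fin m → Matrix (Fin d) (Fin d) ℂ) : Prop :=
  ∀ M : ℕ, ∃ n ≥ M, maxNorm N A n ≠ 0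

/-- If `m_n(𝒜)` does not tend to `0`, then `𝒜` is non-degenerate. -/
theorem nonDegenerate_of_not_tendsto {d m : ℕ} (N : Seminorm ℂ (Matrix (Fin d) (Fin d) ℂ))
    (A : Fin m → Matrix (Fin d) (Fin d) ℂ)
    (h : ¬ Tendsto (fun n => maxNorm N A n) atTop (𝓝 0)) : NonDegenerate N A := by
  intro M
  by_contra! hM
  apply h
  refine tendsto_const_nhds.congr' ?_
  filter_upwards [eventually_ge_atTop M] with n hn
  exact (hM n hn).symm

/-- The semigroup `⟨𝒜⟩` generated by the matrices, including the identity (the empty product). -/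
def semigroup {d m : ℕ} (A : Fin m → Matrix (Fin d) (Fin d) ℂ) :
    Submonoid (Matrix (Fin d) (Fin d) ℂ) :=
  Submonoid.closure (Set.range A)

/-- A matrix is tame if each of its eigenvalues is `0` or a root of unity. -/
def IsTame {d : ℕ} (X : Matrix (Fin d) (Fin d) ℂ) : Prop :=
  ∀ z : ℂ, Module.End.HasEigenvalue (Matrix.toLin' X) z → z = 0 ∨ ∃ n : ℕ, 0 < n ∧ z ^ n = 1

/-- There is a positive integer `a` such that `∏_{i=1}^k (X_i^{2a} - X_i^a) Y_i = 0`
(ordered product) for all `X_1, …, X_k, Y_1, …, Y_k ∈ ⟨𝒜⟩`. -/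
def SatisfiesIdentity {d m : ℕ} (A : Fin m → Matrix (Fin d) (Fin d) ℂ) (k : ℕ) : Prop :=
  ∃ a : ℕ, 0 < a ∧ ∀ X Y : Fin k → Matrix (Fin d) (Fin d) ℂ,
    (∀ i, X i ∈ semigroup A) → (∀ i, Y i ∈ semigroup A) →
      (List.ofFn fun i : Fin k => (X i ^ (2 * a) - X i ^ a) * Y i).prod = 0

end MatrixGrowth

namespace MatrixGrowth

open Polynomial

/-! Let S be the semigroup and, for a > 0, let J be the ideal of its linear span generated by all
x^(2a) - x^a. The identity with k factors and exponent a says that J^k = 0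
(`torsionRightIdeal_pow_eq_bot_iff`, `torsionIdeal_pow_eq_bot_iff`).

Finiteness: reducing the entries to a number field bounds the orders of the roots of unity among the
eigenvalues, so the trace takes finitely many values on S. Hence S is finite modulo the radical of
the trace form, which is nilpotent; this yields some identity. Removing loops from words
(`loop_removal`) then makes S finite modulo J for every a > 0 (`finiteModulo_torsionIdeal`).

Upper bound: a word is rewritten letter by letter through finitely many coset representatives. There
are linearly many errors, each one power of J deeper, so J^k = 0 leaves at most order n^(k-1)
(`exists_seminorm_mul_word_le`).

Lower bound: let s = k - 1 ≥ 1. For z = X^b with suitable b, z^(2(n+1)) - z^(n+1) ≡ (n+1)(z^2 - z)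
modulo J^2. Since J^(s+1) = 0, a product of s such differences, with factors Y_i interspersed, is
exactly (n+1)^s W, and W ≠ 0 for some choice because the identity with s factors fails. Expanding
gives a signed sum of words whose entries are polynomials in n, so a single family of words has an
entry of degree at least s. Its lengths form an arithmetic progression, and submultiplicativity of
m_n reaches the other lengths. If k = 1, then S is finite and the positive numbers m_n take finitely
many values. -/

/-! ### Eigenvalues of bounded order and finiteness of the set of traces. -/

theorem dvd_factorial_of_totient_le {N D : ℕ} (hN : 0 < N) (h : N.totient ≤ D) :
    N ∣ (2 * D).factorial := by
  refine (Nat.dvd_iff_prime_pow_dvd_dvd _ _).2 fun p e hp hpe => ?_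
  rcases Nat.eq_zero_or_pos e with rfl | he
  · simp
  apply Nat.dvd_factorial (pow_pos hp.pos e)
  have h1 : (p ^ e).totient ≤ D :=
    (Nat.le_of_dvd (Nat.totient_pos.2 hN) (Nat.totient_dvd_of_dvd hpe)).trans h
  rw [Nat.totient_prime_pow hp he] at h1
  have h2 : p ^ e = p ^ (e - 1) * p := by rw [← pow_succ, Nat.sub_add_cancel he]
  have h3 : p ≤ 2 * (p - 1) := by have := hp.two_le; omega
  calc p ^ e = p ^ (e - 1) * p := h2
    _ ≤ p ^ (e - 1) * (2 * (p - 1)) := Nat.mul_le_mul_left _ h3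
    _ = 2 * (p ^ (e - 1) * (p - 1)) := by ring
    _ ≤ 2 * D := Nat.mul_le_mul_left _ h1

/-- If an irreducible polynomial over `k` evaluated at a matrix over a finite field extension `L`
is singular, then its degree is at most `d * [L : k]`. -/
theorem natDegree_le_of_det_aeval_eq_zero {k L : Type*} [Field k] [Field L] [Algebra k L]
    [FiniteDimensional k L] {d : ℕ} (X : Matrix (Fin d) (Fin d) L) {f : k[X]}
    (hf : Irreducible f) (hdet : (aeval X f).det = 0) :
    f.natDegree ≤ d * Module.finrank k L := by
  obtain ⟨v, hv, hXv⟩ := Matrix.exists_mulVec_eq_zero_iff.2 hdet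
  let φ : Matrix (Fin d) (Fin d) L →ₐ[k] Module.End k (Fin d → L) :=
    { toFun := fun Y => (Matrix.toLin' Y).restrictScalars k
      map_one' := by ext; simp
      map_mul' := fun Y Z => by ext; simp
      map_zero' := by ext; simp
      map_add' := fun Y Z => by ext; simp
      commutes' := fun r => by
        ext u i
        simp [Matrix.algebraMap_eq_diagonal, Matrix.mulVec_diagonal, Algebra.smul_def] }
  have hφ : ∀ Y u, φ Y u = Y.mulVec u := fun Y u => by simp [φ]
  have hdim : Module.finrank k (Fin d → L) = d * Module.finrank k L := by
    rw [Module.finrank_pi_fintype]; simp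
  -- Otherwise a Bézout relation, applied to `v`, combines f(X)v = 0 with Cayley-Hamilton to give v
  -- = 0.
  have hdvd : f ∣ (φ X).charpoly := by
    by_contra hnd
    obtain ⟨a, b, hab⟩ := (hf.coprime_iff_not_dvd).2 hnd
    have h1 := congrArg (fun g : k[X] => aeval (φ X) g v) hab
    have h2 : aeval (φ X) f v = 0 := by rw [aeval_algHom_apply, hφ, hXv]
    simp only [map_add, map_mul, LinearMap.aeval_self_charpoly, mul_zero, add_zero, map_one,
      Module.End.mul_apply, Module.End.one_apply, h2, map_zero] at h1
    exact hv h1.symm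
  calc f.natDegree ≤ (φ X).charpoly.natDegree :=
        natDegree_le_of_dvd hdvd (LinearMap.charpoly_monic _).ne_zero
    _ = _ := by rw [LinearMap.charpoly_natDegree, hdim]

/-- The roots of unity that occur as eigenvalues in a finitely generated matrix semigroup have
bounded order. -/
theorem exists_pow_eq_one_of_hasEigenvalue {d m : ℕ} (A : Fin m → Matrix (Fin d) (Fin d) ℂ) :
    ∃ b : ℕ, 0 < b ∧ ∀ X ∈ semigroup A, ∀ z : ℂ,
      Module.End.HasEigenvalue (Matrix.toLin' X) z → (∃ n : ℕ, 0 < n ∧ z ^ n = 1) → z ^ b = 1 := by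
  let s : Set ℂ := Set.range fun p : Fin m × Fin d × Fin d => A p.1 p.2.1 p.2.2
  let B : Subalgebra ℚ ℂ := Algebra.adjoin ℚ s
  have hBft : Algebra.FiniteType ℚ B :=
    (Subalgebra.fg_iff_finiteType B).1 ⟨(Set.finite_range _).toFinset,
      congrArg _ (Set.Finite.coe_toFinset _)⟩
  -- By the Nullstellensatz the residue field is a number field. A cyclotomic polynomial singular at
  -- a matrix over `B` stays singular after reduction, which bounds its degree independently of the
  -- matrix.
  obtain ⟨I, hI⟩ := Ideal.exists_maximal B
  let : Field (B ⧸ I) := Ideal.Quotient.field I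
  have : Algebra.FiniteType ℚ (B ⧸ I) := inferInstance
  have : Module.Finite ℚ (B ⧸ I) := finite_of_finite_type_of_isJacobsonRing ℚ (B ⧸ I)
  let ψ : B →ₐ[ℚ] (B ⧸ I) := Ideal.Quotient.mkₐ ℚ I
  let D := d * Module.finrank ℚ (B ⧸ I)
  refine ⟨(2 * D).factorial, Nat.factorial_pos _, fun X hX z hz ⟨n, hn, hzn⟩ => ?_⟩
  have hlift : ∃ X' : Matrix (Fin d) (Fin d) B, B.val.mapMatrix X' = X := by
    have : semigroup A ≤ MonoidHom.mrange (B.val.mapMatrix (m := Fin d)).toMonoidHom := by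
      refine Submonoid.closure_le.2 ?_
      rintro _ ⟨i, rfl⟩
      refine ⟨Matrix.of fun a b => ⟨A i a b, Algebra.subset_adjoin ⟨(i, a, b), rfl⟩⟩, ?_⟩
      ext a b
      simp
    obtain ⟨X', hX'⟩ := this hX
    exact ⟨X', hX'⟩
  obtain ⟨X', rfl⟩ := hlift
  have hN : 0 < orderOf z := orderOf_pos_iff.2 (isOfFinOrder_iff_pow_eq_one.2 ⟨n, hn, hzn⟩)
  have hprim := IsPrimitiveRoot.orderOf z
  have hroot : aeval z (cyclotomic (orderOf z) ℚ) = 0 := by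
    have := hprim.isRoot_cyclotomic hN
    rwa [IsRoot, ← map_cyclotomic _ (algebraMap ℚ ℂ), eval_map_algebraMap] at this
  have hdet : (aeval (B.val.mapMatrix X') (cyclotomic (orderOf z) ℚ)).det = 0 := by
    obtain ⟨v, hv⟩ := hz.exists_hasEigenvector
    refine Matrix.exists_mulVec_eq_zero_iff.1 ⟨v, hv.2, ?_⟩
    have h1 := Module.End.aeval_apply_of_hasEigenvector (p := (cyclotomic (orderOf z) ℚ).map
      (algebraMap ℚ ℂ)) hv
    rw [eval_map_algebraMap, hroot, zero_smul] at h1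
    rw [show Matrix.toLin' (B.val.mapMatrix X') = Matrix.toLinAlgEquiv' (B.val.mapMatrix X')
      from rfl, aeval_algHom_apply, aeval_map_algebraMap] at h1
    simpa using h1
  rw [aeval_algHom_apply] at hdet
  have hdet' : (aeval X' (cyclotomic (orderOf z) ℚ)).det = 0 := by
    have h2 : B.val (aeval X' (cyclotomic (orderOf z) ℚ)).det = 0 := by
      rw [AlgHom.map_det]; exact hdet
    exact Subtype.ext h2
  have h3 : (aeval (ψ.mapMatrix X') (cyclotomic (orderOf z) ℚ)).det = 0 := by
    rw [aeval_algHom_apply, ← AlgHom.map_det, hdet', map_zero]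
  have h4 := natDegree_le_of_det_aeval_eq_zero _ (cyclotomic.irreducible_rat hN) h3
  rw [natDegree_cyclotomic] at h4
  exact orderOf_dvd_iff_pow_eq_one.1 (dvd_factorial_of_totient_le hN h4)

theorem finite_setOf_multiset_sum {M : Type*} [AddCommMonoid M] {T : Set M} (hT : T.Finite)
    (n : ℕ) : {x : M | ∃ s : Multiset M, s.card = n ∧ (∀ y ∈ s, y ∈ T) ∧ s.sum = x}.Finite := by
  induction n with
  | zero =>
    refine (Set.finite_singleton (0 : M)).subset ?_
    rintro x ⟨s, hs, -, rfl⟩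
    simp [Multiset.card_eq_zero.1 hs]
  | succ n ih =>
    refine (Set.Finite.image2 (· + ·) hT ih).subset ?_
    rintro x ⟨s, hs, hsT, rfl⟩
    obtain ⟨a, ha⟩ := Multiset.card_pos_iff_exists_mem.1 (hs.symm ▸ n.succ_pos : 0 < s.card)
    obtain ⟨t, rfl⟩ := Multiset.exists_cons_of_mem ha
    have ht : t.card = n := by simpa using hs
    exact ⟨a, hsT a (by simp), t.sum,
      ⟨t, ht, fun y hy => hsT y (Multiset.mem_cons_of_mem hy), rfl⟩, by simp⟩

/-- In a tame finitely generated matrix semigroup the trace takes only finitely many values. -/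
theorem finite_trace_image {d m : ℕ} (A : Fin m → Matrix (Fin d) (Fin d) ℂ)
    (htame : ∀ X ∈ semigroup A, IsTame X) :
    (Matrix.trace '' (semigroup A : Set (Matrix (Fin d) (Fin d) ℂ))).Finite := by
  obtain ⟨b, hb, hbz⟩ := exists_pow_eq_one_of_hasEigenvalue A
  have hT : ({0} ∪ {z : ℂ | z ^ b = 1}).Finite := by
    refine (Set.finite_singleton 0).union ?_
    have := (nthRoots b (1 : ℂ)).toFinset.finite_toSet
    refine this.subset fun z hz => ?_
    simpa [mem_nthRoots hb] using hz
  refine (finite_setOf_multiset_sum hT d).subset ?_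
  rintro _ ⟨X, hX, rfl⟩
  refine ⟨X.charpoly.roots, ?_, fun z hz => ?_, (Matrix.trace_eq_sum_roots_charpoly X).symm⟩
  · rw [splits_iff_card_roots.1 (IsAlgClosed.splits X.charpoly), Matrix.charpoly_natDegree_eq_dim,
      Fintype.card_fin]
  · have hev : Module.End.HasEigenvalue (Matrix.toLin' X) z := by
      rw [Module.End.hasEigenvalue_iff_isRoot_charpoly, Matrix.charpoly_toLin']
      exact isRoot_of_mem_roots hz
    rcases htame X hX z hev with h | h
    · exact Or.inl h
    · exact Or.inr (hbz X hX z hev h)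

/-! ### A trace criterion for nilpotency, and words in the generators. -/

/-- A matrix all of whose trace pairings with its own positive powers vanish is nilpotent. -/
theorem isNilpotent_of_trace_mul_aeval_eq_zero {d : ℕ} (X : Matrix (Fin d) (Fin d) ℂ)
    (h : ∀ p : ℂ[X], (X * aeval X p).trace = 0) : IsNilpotent X := by
  obtain ⟨g, hg, hndvd⟩ := exists_eq_pow_rootMultiplicity_mul_and_not_dvd X.charpoly
    (Matrix.charpoly_monic X).ne_zero 0
  rw [map_zero, sub_zero] at hg hndvd
  set r := rootMultiplicity 0 X.charpoly
  have hcop : IsCoprime ((Polynomial.X : ℂ[X]) ^ (r + 1)) g :=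
    ((irreducible_X.coprime_iff_not_dvd).2 hndvd).pow_left
  obtain ⟨u, w, huw⟩ := hcop
  have hcp : aeval X (Polynomial.X ^ r * g) = 0 := by rw [← hg]; exact Matrix.aeval_self_charpoly X
  -- `E` is the spectral projection onto the nonzero eigenvalues. It is a multiple of X by a
  -- polynomial in X, so its trace, which is its rank, vanishes.
  set E : Matrix (Fin d) (Fin d) ℂ := aeval X (u * Polynomial.X ^ (r + 1)) with hE
  have hE1 : E + aeval X (w * g) = 1 := by rw [hE, ← map_add, huw, map_one]
  have hE2 : E * aeval X (w * g) = 0 := by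
    rw [hE, ← map_mul, show u * Polynomial.X ^ (r + 1) * (w * g) =
      u * Polynomial.X * w * (Polynomial.X ^ r * g) by ring, map_mul, hcp, mul_zero]
  have hidem : E * E = E := by
    have := congrArg (E * ·) hE1
    simpa only [mul_add, hE2, add_zero, mul_one] using this
  have htr : E.trace = 0 := by
    have := h (u * Polynomial.X ^ r)
    rw [hE, show u * Polynomial.X ^ (r + 1) = Polynomial.X * (u * Polynomial.X ^ r) by ring,
      map_mul, aeval_X]
    exact this
  have hE0 : E = 0 := by
    have hid : IsIdempotentElem (Matrix.toLin' E) := by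
      unfold IsIdempotentElem
      rw [Module.End.mul_eq_comp, ← Matrix.toLin'_mul, hidem]
    have h5 := (LinearMap.IsIdempotentElem.trace_eq_zero_iff hid).1
      (by rw [Matrix.trace_toLin'_eq, htr])
    exact Matrix.toLin'.injective (h5.trans
      (map_zero (Matrix.toLin' (m := Fin d) (n := Fin d) (R := ℂ))).symm)
  refine ⟨r, ?_⟩
  have h6 : aeval X (Polynomial.X ^ r : ℂ[X]) * aeval X (w * g) = 0 := by
    rw [← map_mul, show Polynomial.X ^ r * (w * g) = w * (Polynomial.X ^ r * g) by ring, map_mul,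
      hcp, mul_zero]
  rw [hE0, zero_add] at hE1
  rw [hE1, mul_one] at h6
  simpa using h6

theorem list_map_prod_mem {ι M : Type*} [Monoid M] {S : Submonoid M} {A : ι → M} (hA : ∀ i, A i ∈ S)
    (l : List ι) : (l.map A).prod ∈ S :=
  S.list_prod_mem fun x hx => by
    obtain ⟨i, -, rfl⟩ := List.mem_map.1 hx
    exact hA i

theorem exists_list_of_mem_closure_range {ι M : Type*} [Monoid M] {A : ι → M} {s : M}
    (hs : s ∈ Submonoid.closure (Set.range A)) : ∃ l : List ι, (l.map A).prod = s := by
  induction hs using Submonoid.closure_induction with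
  | mem x hx => obtain ⟨i, rfl⟩ := hx; exact ⟨[i], by simp⟩
  | one => exact ⟨[], by simp⟩
  | mul x y _ _ hx hy =>
    obtain ⟨l, rfl⟩ := hx
    obtain ⟨l', rfl⟩ := hy
    exact ⟨l ++ l', by simp⟩

/-! ### Finiteness of a monoid modulo an ideal. -/

section Algebra

variable {M : Type*} [Ring M] [Algebra ℂ M]

/-- `S` meets only finitely many cosets of `J`. -/
def FiniteModulo (S : Submonoid M) (J : Submodule ℂ M) : Prop :=
  ∃ T : Set M, T.Finite ∧ T ⊆ S ∧ ∀ s ∈ S, ∃ r ∈ T, s - r ∈ J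

/-- `J` is stable under multiplication by `S` on both sides. -/
def IsStable (S : Submonoid M) (J : Submodule ℂ M) : Prop :=
  ∀ s ∈ S, ∀ x ∈ J, s * x ∈ J ∧ x * s ∈ J

theorem FiniteModulo.mono {S : Submonoid M} {I J : Submodule ℂ M} (h : FiniteModulo S I)
    (hIJ : I ≤ J) : FiniteModulo S J := by
  obtain ⟨T, hT, hTS, hr⟩ := h
  refine ⟨T, hT, hTS, fun s hs => ?_⟩
  obtain ⟨r, hrT, hsr⟩ := hr s hs
  exact ⟨r, hrT, hIJ hsr⟩

theorem FiniteModulo.exists_choice {S : Submonoid M} {J : Submodule ℂ M} (h : FiniteModulo S J) :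
    ∃ q : ℕ, ∃ f : M → Fin q, ∀ s ∈ S, ∀ t ∈ S, f s = f t → s - t ∈ J := by
  obtain ⟨T, hT, hTS, hr⟩ := h
  choose! g hgT hg using hr
  have : Fintype T := hT.fintype
  by_cases hne : Nonempty T
  · obtain ⟨t₀⟩ := hne
    classical
    refine ⟨Fintype.card T, fun s => Fintype.equivFin T (if hs : g s ∈ T then ⟨g s, hs⟩ else t₀),
      fun s hs t ht hst => ?_⟩
    have h1 := (Fintype.equivFin T).injective hst
    rw [dif_pos (hgT s hs), dif_pos (hgT t ht), Subtype.mk.injEq] at h1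
    have := J.sub_mem (hg s hs) (hg t ht)
    rwa [h1, sub_sub_sub_cancel_right] at this
  · exact absurd ⟨⟨g 1, hgT 1 S.one_mem⟩⟩ hne

theorem pow_add_mul_sub_mem {J : Submodule ℂ M} {S : Submonoid M} (hJ : IsStable S J) {x : M}
    (hx : x ∈ S) {i p : ℕ} (h : x ^ (i + p) - x ^ i ∈ J) (l : ℕ) {c : ℕ} (hc : i ≤ c) :
    x ^ (c + p * l) - x ^ c ∈ J := by
  induction l with
  | zero => simp
  | succ l ih =>
    have h1 : x ^ (c + p * l - i) * (x ^ (i + p) - x ^ i) ∈ J := (hJ _ (S.pow_mem hx _) _ h).1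
    rw [mul_sub, ← pow_add, ← pow_add, show c + p * l - i + (i + p) = c + p * (l + 1) by
      rw [mul_add]; omega, show c + p * l - i + i = c + p * l by omega] at h1
    simpa using J.add_mem h1 ih

/-- In a monoid that is finite modulo `J`, a common power of all elements is idempotent
modulo `J`. -/
theorem FiniteModulo.exists_pow_sub_pow_mem {S : Submonoid M} {J : Submodule ℂ M}
    (hJ : IsStable S J) (h : FiniteModulo S J) :
    ∃ a : ℕ, 0 < a ∧ ∀ x ∈ S, x ^ (2 * a) - x ^ a ∈ J := by
  obtain ⟨q, f, hf⟩ := h.exists_choice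
  -- Modulo `J` the powers of `x` have a preperiod and a period at most `q`; q! is at least the
  -- former and a multiple of the latter.
  refine ⟨q.factorial, q.factorial_pos, fun x hx => ?_⟩
  have hni : ¬ Function.Injective fun j : Fin (q + 1) => f (x ^ (j : ℕ)) := fun hinj => by
    simpa using Fintype.card_le_of_injective _ hinj
  obtain ⟨i, j, hij, hne⟩ : ∃ i j : Fin (q + 1), f (x ^ (i : ℕ)) = f (x ^ (j : ℕ)) ∧ i < j := by
    simp only [Function.Injective, not_forall] at hni
    obtain ⟨i, j, hij, hne⟩ := hni
    rcases lt_or_gt_of_ne hne with h | h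
    · exact ⟨i, j, hij, h⟩
    · exact ⟨j, i, hij.symm, h⟩
  have hlt : (i : ℕ) < j := hne
  have hjq : (j : ℕ) ≤ q := Nat.lt_succ_iff.1 j.2
  have hmem := hf _ (S.pow_mem hx _) _ (S.pow_mem hx _) hij.symm
  obtain ⟨l, hl⟩ : (j - i : ℕ) ∣ q.factorial := Nat.dvd_factorial (by omega) (by omega)
  have hp : x ^ ((i : ℕ) + (j - i)) - x ^ (i : ℕ) ∈ J := by
    rwa [show (i : ℕ) + (j - i) = j by omega]
  have := pow_add_mul_sub_mem hJ hx hp l (c := q.factorial)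
    ((show (i : ℕ) ≤ q by omega).trans q.self_le_factorial)
  rwa [← hl, ← two_mul] at this

/-- Removing a loop from a word: if `x v ≡ x` and `v y ≡ y` modulo `I`, where `I * I ≤ J`, and
`v` has finite order modulo `J`, then `x v y ≡ x y` modulo `J`. -/
theorem loop_removal {S : Submonoid M} {I J : Submodule ℂ M} (hI : IsStable S I)
    (hJ : IsStable S J) (hIJ : I * I ≤ J) {x v y : M} (hx : x ∈ S) (hv : v ∈ S) (hy : y ∈ S)
    (hxv : x * v - x ∈ I) (hvy : v * y - y ∈ I) {a : ℕ} (ha : 0 < a)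
    (hva : v ^ (2 * a) - v ^ a ∈ J) : x * v * y - x * y ∈ J := by
  have h1 : ∀ n : ℕ, x * v ^ n - x ∈ I := fun n => by
    induction n with
    | zero => simp
    | succ n ih =>
      have := I.add_mem (hI v hv _ ih).2 hxv
      rwa [sub_mul, mul_assoc, ← pow_succ, sub_add_sub_cancel] at this
  set δ := x * (v * y - y) with hδ
  -- Modulo `J` each further copy of `v` adds the same `δ`, since the cross term lies in I * I.
  have h2 : ∀ n : ℕ, x * v ^ n * y - x * y - (n : ℂ) • δ ∈ J := fun n => by
    induction n with
    | zero => simp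
    | succ n ih =>
      have h3 : (x * v ^ n - x) * (v * y - y) ∈ J := hIJ (Submodule.mul_mem_mul (h1 n) hvy)
      have := J.add_mem ih h3
      convert this using 1
      rw [Nat.cast_succ, add_smul, one_smul, hδ, pow_succ]
      noncomm_ring
  have h4 : x * (v ^ (2 * a) - v ^ a) * y ∈ J := (hJ y hy _ ((hJ x hx _ hva).1)).2
  -- Torsion makes the values at n = 2a and n = a agree modulo `J`, while linearity makes them
  -- differ by aδ.
  have h5 : (a : ℂ) • δ ∈ J := by
    have := J.sub_mem (J.sub_mem h4 (h2 (2 * a))) (J.neg_mem (h2 a))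
    have h6 : (((2 * a : ℕ) : ℂ) - (a : ℂ)) • δ = (a : ℂ) • δ := by
      congr 1; push_cast; ring
    rw [← h6]
    convert this using 1
    rw [sub_smul, mul_sub, sub_mul]
    abel
  have h7 : δ ∈ J := by
    have := J.smul_mem ((a : ℂ)⁻¹) h5
    rwa [smul_smul, inv_mul_cancel₀ (Nat.cast_ne_zero.2 ha.ne'), one_smul] at this
  rwa [hδ, mul_sub, ← mul_assoc] at h7

/-- If a finitely generated monoid is finite modulo `I` and torsion modulo `J`, where
`I * I ≤ J`, then it is finite modulo `J`. -/
theorem FiniteModulo.of_mul_self_le {ι : Type*} [Finite ι] {A : ι → M} {S : Submonoid M}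
    (hS : S = Submonoid.closure (Set.range A)) {I J : Submodule ℂ M} (hI : IsStable S I)
    (hJ : IsStable S J) (hIJ : I * I ≤ J) (hfin : FiniteModulo S I)
    {a : ℕ} (ha : 0 < a) (htors : ∀ v ∈ S, v ^ (2 * a) - v ^ a ∈ J) : FiniteModulo S J := by
  have hA : ∀ i, A i ∈ S := fun i => hS ▸ Submonoid.subset_closure ⟨i, rfl⟩
  obtain ⟨q, f, hf⟩ := hfin.exists_choice
  have hshort : ∀ n : ℕ, ∀ l : List ι, l.length = n →
      ∃ l' : List ι, l'.length < q * q + 1 ∧ (l.map A).prod - (l'.map A).prod ∈ J := by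
    intro n
    induction n using Nat.strong_induction_on with
    | _ n ih =>
      intro l hl
      by_cases hlt : n < q * q + 1
      · exact ⟨l, hl ▸ hlt, by simp⟩
      -- Pigeonhole over the cut points: two cuts have prefixes in the same class and suffixes in
      -- the same class, so the segment between them is a removable loop.
      have hni : ¬ Function.Injective fun j : Fin (q * q + 1) =>
          (f ((l.take j).map A).prod, f ((l.drop j).map A).prod) := fun hinj => by
        simpa using Fintype.card_le_of_injective _ hinj
      obtain ⟨i, j, hij, hne⟩ : ∃ i j : Fin (q * q + 1),
          (f ((l.take i).map A).prod, f ((l.drop i).map A).prod) =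
          (f ((l.take j).map A).prod, f ((l.drop j).map A).prod) ∧ i < j := by
        simp only [Function.Injective, not_forall] at hni
        obtain ⟨i, j, hij, hne⟩ := hni
        rcases lt_or_gt_of_ne hne with h | h
        · exact ⟨i, j, hij, h⟩
        · exact ⟨j, i, hij.symm, h⟩
      obtain ⟨hij1, hij2⟩ := Prod.mk.inj hij
      have hlt' : (i : ℕ) < j := hne
      set x := l.take i with hx
      set v := (l.drop i).take (j - i) with hv
      set y := l.drop j with hy
      have hxv : l.take j = x ++ v := by
        rw [hx, hv, ← List.take_add]; congr 1; omega
      have hvy : l.drop i = v ++ y := by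
        have := (List.take_append_drop (j - i) (l.drop i)).symm
        rwa [List.drop_drop, show (i : ℕ) + (j - i) = j by omega] at this
      have hxvy : l = x ++ v ++ y := by rw [← hxv, hy, List.take_append_drop]
      have e1 := hf _ (list_map_prod_mem hA _) _ (list_map_prod_mem hA _) hij1.symm
      have e2 := hf _ (list_map_prod_mem hA _) _ (list_map_prod_mem hA _) hij2
      rw [hxv, List.map_append, List.prod_append] at e1
      rw [hvy, List.map_append, List.prod_append] at e2
      have e3 := loop_removal hI hJ hIJ (list_map_prod_mem hA x) (list_map_prod_mem hA v)
        (list_map_prod_mem hA y) e1 e2 ha (htors _ (list_map_prod_mem hA v))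
      have hlen : (x ++ y).length < n := by
        have := congrArg List.length hxvy
        have hjl : (j : ℕ) ≤ l.length := by have := j.2; omega
        simp only [List.length_append] at this ⊢
        have hvl : 0 < v.length := by
          rw [hv, List.length_take, List.length_drop]; omega
        omega
      obtain ⟨l', hl', hmem⟩ := ih _ hlen (x ++ y) rfl
      refine ⟨l', hl', ?_⟩
      have := J.add_mem e3 hmem
      rw [List.map_append, List.prod_append, sub_add_sub_cancel] at this
      rwa [hxvy, List.map_append, List.prod_append, List.map_append, List.prod_append]
  refine ⟨(fun l : List ι => (l.map A).prod) '' {l | l.length < q * q + 1},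
    (List.finite_length_lt ι _).image _, ?_, fun s hs => ?_⟩
  · rintro _ ⟨l, -, rfl⟩
    exact list_map_prod_mem hA l
  · obtain ⟨l, rfl⟩ := exists_list_of_mem_closure_range (hS ▸ hs)
    obtain ⟨l', hl', hmem⟩ := hshort _ l rfl
    exact ⟨_, ⟨l', hl', rfl⟩, hmem⟩

theorem IsStable.sup {S : Submonoid M} {I J : Submodule ℂ M} (hI : IsStable S I)
    (hJ : IsStable S J) : IsStable S (I ⊔ J) := by
  intro s hs x hx
  obtain ⟨y, hy, z, hz, rfl⟩ := Submodule.mem_sup.1 hx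
  rw [mul_add, add_mul]
  exact ⟨Submodule.add_mem_sup (hI s hs y hy).1 (hJ s hs z hz).1,
    Submodule.add_mem_sup (hI s hs y hy).2 (hJ s hs z hz).2⟩

theorem IsStable.mul {S : Submonoid M} {I J : Submodule ℂ M} (hI : IsStable S I)
    (hJ : IsStable S J) : IsStable S (I * J) := by
  intro s hs x hx
  refine Submodule.mul_induction_on hx (fun y hy z hz => ⟨?_, ?_⟩) fun y z hy hz => ?_
  · rw [← mul_assoc]; exact Submodule.mul_mem_mul (hI s hs y hy).1 hz
  · rw [mul_assoc]; exact Submodule.mul_mem_mul hy (hJ s hs z hz).2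
  · rw [mul_add, add_mul]
    exact ⟨add_mem hy.1 hz.1, add_mem hy.2 hz.2⟩

theorem IsStable.mul_span_le {S : Submonoid M} {J : Submodule ℂ M} (hJ : IsStable S J) :
    J * Submodule.span ℂ (S : Set M) ≤ J := by
  conv_lhs => rw [← Submodule.span_eq J]
  rw [Submodule.span_mul_span, Submodule.span_le]
  rintro _ ⟨x, hx, s, hs, rfl⟩
  exact (hJ s hs x hx).2

theorem IsStable.span_mul_le {S : Submonoid M} {J : Submodule ℂ M} (hJ : IsStable S J) :
    Submodule.span ℂ (S : Set M) * J ≤ J := by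
  conv_lhs => rw [← Submodule.span_eq J]
  rw [Submodule.span_mul_span, Submodule.span_le]
  rintro _ ⟨s, hs, x, hx, rfl⟩
  exact (hJ s hs x hx).1

/-- If `S` is finite modulo a nilpotent ideal `I` of its linear span and torsion modulo `J`, then
it is finite modulo `J`. -/
theorem FiniteModulo.of_isNilpotent {ι : Type*} [Finite ι] {A : ι → M} {S : Submonoid M}
    (hS : S = Submonoid.closure (Set.range A)) {I J : Submodule ℂ M} (hI : IsStable S I)
    (hIS : I ≤ Submodule.span ℂ (S : Set M)) (hJ : IsStable S J)
    (hJS : J ≤ Submodule.span ℂ (S : Set M)) (hnil : IsNilpotent I)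
    (hfin : FiniteModulo S I) {a : ℕ} (ha : 0 < a)
    (htors : ∀ v ∈ S, v ^ (2 * a) - v ^ a ∈ J) : FiniteModulo S J := by
  -- Each step squares `I'`, since (I' + J)^2 ≤ I'^2 + J, until the nilpotent part disappears.
  have key : ∀ t : ℕ, ∃ I' : Submodule ℂ M, I' ≤ I ^ (2 ^ t) ∧ IsStable S I' ∧
      I' ≤ Submodule.span ℂ (S : Set M) ∧ FiniteModulo S (I' ⊔ J) := by
    intro t
    induction t with
    | zero => exact ⟨I, by simp, hI, hIS, hfin.mono le_sup_left⟩
    | succ t ih =>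
      obtain ⟨I', hle, hst, hspan, hf⟩ := ih
      refine ⟨I' * I', ?_, hst.mul hst, ?_, ?_⟩
      · rw [pow_succ 2 t, mul_two, pow_add]; exact mul_le_mul' hle hle
      · exact (mul_le_mul' le_rfl hspan).trans (hst.mul_span_le.trans hspan)
      · refine FiniteModulo.of_mul_self_le hS (hst.sup hJ) ((hst.mul hst).sup hJ) ?_ hf ha
          fun v hv => Submodule.mem_sup_right (htors v hv)
        rw [Submodule.sup_mul, Submodule.mul_sup]
        have h1 : I' * J ≤ J := (mul_le_mul' hspan le_rfl).trans hJ.span_mul_le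
        have h2 : J * (I' ⊔ J) ≤ J := (mul_le_mul' le_rfl (sup_le hspan hJS)).trans hJ.mul_span_le
        exact sup_le (sup_le_sup_left h1 _) (h2.trans le_sup_right)
  obtain ⟨t, ht⟩ := hnil
  obtain ⟨I', hle, -, -, hf⟩ := key t
  refine hf.mono (sup_le (hle.trans ?_) le_rfl)
  have : I ^ (2 ^ t) = 0 := pow_eq_zero_of_le Nat.lt_two_pow_self.le ht
  rw [this]
  exact bot_le

end Algebra

/-! ### Nilpotent matrix spaces and the radical of the trace form. -/

/-- Take a minimal nonzero subspace of the form Pv. As P^2 = P, some u in Pv has Pu ≠ 0; then Pu =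
Pv by minimality, so pu = u for some p in P, and nilpotency of p forces u = 0. -/
theorem eq_bot_of_mul_self_eq_of_forall_isNilpotent {d : ℕ}
    {P : Submodule ℂ (Matrix (Fin d) (Fin d) ℂ)} (hP : P * P = P)
    (hnil : ∀ X ∈ P, IsNilpotent X) : P = ⊥ := by
  let f : (Fin d → ℂ) → (Matrix (Fin d) (Fin d) ℂ →ₗ[ℂ] (Fin d → ℂ)) := fun v =>
    (LinearMap.applyₗ v).comp (Matrix.toLin' (R := ℂ)).toLinearMap
  have hf : ∀ v X, f v X = X.mulVec v := fun v X => by simp [f]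
  have hmem : ∀ {v u}, u ∈ P.map (f v) ↔ ∃ X ∈ P, X.mulVec v = u := fun {v u} => by
    simp [Submodule.mem_map, hf]
  by_contra hne
  obtain ⟨X, hX, hX0⟩ := P.ne_bot_iff.1 hne
  have hex : {W : Submodule ℂ (Fin d → ℂ) | W ≠ ⊥ ∧ ∃ v, P.map (f v) = W}.Nonempty := by
    obtain ⟨v, hv⟩ : ∃ v, X.mulVec v ≠ 0 := by
      by_contra! h
      exact hX0 (Matrix.toLin'.injective (LinearMap.ext fun v => by simpa using h v))
    exact ⟨P.map (f v), (Submodule.ne_bot_iff _).2 ⟨_, hmem.2 ⟨X, hX, rfl⟩, hv⟩, v, rfl⟩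
  obtain ⟨W, ⟨hW, v, rfl⟩, hmin⟩ := IsArtinian.set_has_minimal _ hex
  obtain ⟨u, hu, hPu⟩ : ∃ u ∈ P.map (f v), P.map (f u) ≠ ⊥ := by
    by_contra! h
    apply hW
    have hker : P * P ≤ LinearMap.ker (f v) := Submodule.mul_le.2 fun p hp q hq => by
      have h1 : p.mulVec (q.mulVec v) ∈ P.map (f (q.mulVec v)) := hmem.2 ⟨p, hp, rfl⟩
      rw [h _ (hmem.2 ⟨q, hq, rfl⟩), Submodule.mem_bot] at h1
      rw [LinearMap.mem_ker, hf, ← Matrix.mulVec_mulVec, h1]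
    rw [hP] at hker
    exact LinearMap.le_ker_iff_map.1 hker
  have hle : P.map (f u) ≤ P.map (f v) := by
    intro w hw
    obtain ⟨p, hp, rfl⟩ := hmem.1 hw
    obtain ⟨q, hq, rfl⟩ := hmem.1 hu
    refine hmem.2 ⟨p * q, hP ▸ Submodule.mul_mem_mul hp hq, ?_⟩
    rw [Matrix.mulVec_mulVec]
  have heq : P.map (f u) = P.map (f v) := by
    by_contra h
    exact hmin _ ⟨hPu, u, rfl⟩ (lt_of_le_of_ne hle h)
  obtain ⟨p, hp, hpu⟩ := hmem.1 (heq ▸ hu : u ∈ P.map (f u))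
  obtain ⟨n, hn⟩ := hnil p hp
  have hpow : ∀ n : ℕ, (p ^ n).mulVec u = u := fun n => by
    induction n with
    | zero => simp
    | succ n ih => rw [pow_succ, ← Matrix.mulVec_mulVec, hpu, ih]
  have hu0 : u = 0 := by rw [← hpow n, hn, Matrix.zero_mulVec]
  apply hPu
  rw [eq_bot_iff]
  intro w hw
  obtain ⟨p, -, rfl⟩ := hmem.1 hw
  simp [hu0]

/-- A multiplicatively closed space of nilpotent matrices is nilpotent. -/
theorem isNilpotent_of_forall_isNilpotent {d : ℕ}
    {I : Submodule ℂ (Matrix (Fin d) (Fin d) ℂ)} (hI : I * I ≤ I)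
    (hnil : ∀ X ∈ I, IsNilpotent X) : IsNilpotent I := by
  have hle : ∀ n : ℕ, I ^ (n + 1) ≤ I := fun n => by
    induction n with
    | zero => simp
    | succ n ih => rw [pow_succ]; exact (mul_le_mul' ih le_rfl).trans hI
  -- The powers decrease, hence stabilise at a space equal to its own square.
  have hanti : Antitone fun n : ℕ => I ^ (n + 1) := antitone_nat_of_succ_le fun n => by
    rw [pow_succ', pow_succ' I n, ← mul_assoc]
    exact mul_le_mul' hI le_rfl
  obtain ⟨n, hn⟩ := IsArtinian.monotone_stabilizes
    (⟨fun n => OrderDual.toDual (I ^ (n + 1)), fun _ _ h => hanti h⟩ :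
      ℕ →o (Submodule ℂ (Matrix (Fin d) (Fin d) ℂ))ᵒᵈ)
  have hn' : I ^ (n + 1) = I ^ (n + 1 + n + 1) := hn (n + 1 + n) (by omega)
  refine ⟨n + 1, eq_bot_of_mul_self_eq_of_forall_isNilpotent ?_ fun X hX => hnil X (hle n hX)⟩
  rw [← pow_add]
  exact hn'.symm

/-- The radical of the trace form on the linear span of `S`. -/
def traceRadical {d : ℕ} (S : Submonoid (Matrix (Fin d) (Fin d) ℂ)) :
    Submodule ℂ (Matrix (Fin d) (Fin d) ℂ) where
  carrier := {X | X ∈ Submodule.span ℂ (S : Set (Matrix (Fin d) (Fin d) ℂ)) ∧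
    ∀ s ∈ S, (X * s).trace = 0}
  add_mem' := fun {X Y} hX hY => ⟨add_mem hX.1 hY.1, fun s hs => by
    rw [add_mul, Matrix.trace_add, hX.2 s hs, hY.2 s hs, add_zero]⟩
  zero_mem' := ⟨zero_mem _, fun s _ => by simp⟩
  smul_mem' := fun c X hX => ⟨Submodule.smul_mem _ _ hX.1, fun s hs => by
    rw [smul_mul_assoc, Matrix.trace_smul, hX.2 s hs, smul_zero]⟩

section TraceRadical

variable {d : ℕ} {S : Submonoid (Matrix (Fin d) (Fin d) ℂ)}

theorem traceRadical_le : traceRadical S ≤ Submodule.span ℂ (S : Set _) := fun _ hX => hX.1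

theorem mul_mem_span {M : Type*} [Ring M] [Algebra ℂ M] {S : Submonoid M} {x y : M}
    (hx : x ∈ Submodule.span ℂ (S : Set M)) (hy : y ∈ Submodule.span ℂ (S : Set M)) :
    x * y ∈ Submodule.span ℂ (S : Set M) := by
  have h := Submodule.mul_mem_mul hx hy
  rw [Submodule.span_mul_span] at h
  refine Submodule.span_mono ?_ h
  rintro _ ⟨s, hs, t, ht, rfl⟩
  exact S.mul_mem hs ht

theorem aeval_mem_span {M : Type*} [Ring M] [Algebra ℂ M] {S : Submonoid M} {x : M}
    (hx : x ∈ Submodule.span ℂ (S : Set M)) (p : Polynomial ℂ) :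
    Polynomial.aeval x p ∈ Submodule.span ℂ (S : Set M) := by
  induction p using Polynomial.induction_on with
  | C a =>
    rw [Polynomial.aeval_C, Algebra.algebraMap_eq_smul_one]
    exact Submodule.smul_mem _ _ (Submodule.subset_span S.one_mem)
  | add p q hp hq => rw [map_add]; exact add_mem hp hq
  | monomial n a h =>
    rw [pow_succ, ← mul_assoc, map_mul, Polynomial.aeval_X]
    exact mul_mem_span h hx

theorem isStable_traceRadical : IsStable S (traceRadical S) := by
  intro s hs X hX
  have hs' : s ∈ Submodule.span ℂ (S : Set (Matrix (Fin d) (Fin d) ℂ)) := Submodule.subset_span hs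
  refine ⟨⟨mul_mem_span hs' hX.1, fun t ht => ?_⟩, ⟨mul_mem_span hX.1 hs', fun t ht => ?_⟩⟩
  · rw [mul_assoc, Matrix.trace_mul_comm, mul_assoc]
    exact hX.2 _ (S.mul_mem ht hs)
  · rw [mul_assoc]
    exact hX.2 _ (S.mul_mem hs ht)

theorem trace_mul_eq_zero_of_mem_traceRadical {X Y : Matrix (Fin d) (Fin d) ℂ}
    (hX : X ∈ traceRadical S) (hY : Y ∈ Submodule.span ℂ (S : Set (Matrix (Fin d) (Fin d) ℂ))) :
    (X * Y).trace = 0 := by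
  induction hY using Submodule.span_induction with
  | mem s hs => exact hX.2 s hs
  | zero => simp
  | add Y Z _ _ hY hZ => rw [mul_add, Matrix.trace_add, hY, hZ, add_zero]
  | smul c Y _ hY => rw [mul_smul_comm, Matrix.trace_smul, hY, smul_zero]

/-- Polynomials in an element of the radical stay in the span, so the trace criterion makes every
element nilpotent. -/
theorem isNilpotent_traceRadical : IsNilpotent (traceRadical S) :=
  isNilpotent_of_forall_isNilpotent
    ((mul_le_mul' le_rfl traceRadical_le).trans isStable_traceRadical.mul_span_le) fun X hX =>
    isNilpotent_of_trace_mul_aeval_eq_zero X fun p =>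
      trace_mul_eq_zero_of_mem_traceRadical hX (aeval_mem_span hX.1 p)

/-- If the trace takes finitely many values on `S`, then `S` is finite modulo the radical of the
trace form. -/
theorem finiteModulo_traceRadical
    (hfin : (Matrix.trace '' (S : Set (Matrix (Fin d) (Fin d) ℂ))).Finite) :
    FiniteModulo S (traceRadical S) := by
  obtain ⟨B, hBS, hspan, hli⟩ := exists_linearIndependent ℂ (S : Set (Matrix (Fin d) (Fin d) ℂ))
  have hB : Finite B := hli.finite
  -- Traces against a basis of the span taken from `S` determine an element of `S` modulo the
  -- radical, and each coordinate takes finitely many values.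
  let φ : Matrix (Fin d) (Fin d) ℂ → B → ℂ := fun s b => (s * b).trace
  have hφ : (φ '' (S : Set (Matrix (Fin d) (Fin d) ℂ))).Finite := by
    refine (Set.Finite.pi' fun _ : B => hfin).subset ?_
    rintro _ ⟨s, hs, rfl⟩ b
    exact ⟨s * b, S.mul_mem hs (hBS b.2), rfl⟩
  obtain ⟨T, hTS, hT⟩ := Set.exists_subset_bijOn (S : Set (Matrix (Fin d) (Fin d) ℂ)) φ
  refine ⟨T, Set.Finite.of_finite_image (hT.image_eq.symm ▸ hφ) hT.injOn, hTS, fun s hs => ?_⟩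
  obtain ⟨r, hrT, hr⟩ := hT.surjOn ⟨s, hs, rfl⟩
  refine ⟨r, hrT, sub_mem (Submodule.subset_span hs) (Submodule.subset_span (hTS hrT)),
    fun t ht => ?_⟩
  have ht' : t ∈ Submodule.span ℂ B := hspan ▸ Submodule.subset_span ht
  clear ht
  induction ht' using Submodule.span_induction with
  | mem b hb =>
    have := congrFun hr ⟨b, hb⟩
    rw [sub_mul, Matrix.trace_sub, sub_eq_zero]
    exact this.symm
  | zero => simp
  | add Y Z _ _ hY hZ => rw [mul_add, Matrix.trace_add, hY, hZ, add_zero]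
  | smul c Y _ hY => rw [mul_smul_comm, Matrix.trace_smul, hY, smul_zero]

end TraceRadical

/-! ### Torsion ideals and the identities they encode. -/

/-- The right ideal, in the linear span of `S`, generated by the differences
`x ^ (2 * a) - x ^ a`. -/
def torsionRightIdeal {M : Type*} [Ring M] [Algebra ℂ M] (S : Submonoid M) (a : ℕ) :
    Submodule ℂ M :=
  Submodule.span ℂ {z | ∃ x ∈ S, ∃ y ∈ S, z = (x ^ (2 * a) - x ^ a) * y}

/-- The two-sided ideal, in the linear span of `S`, generated by the differences
`x ^ (2 * a) - x ^ a`. -/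
def torsionIdeal {M : Type*} [Ring M] [Algebra ℂ M] (S : Submonoid M) (a : ℕ) :
    Submodule ℂ M :=
  Submodule.span ℂ (S : Set M) * torsionRightIdeal S a

section TorsionIdeal

variable {M : Type*} [Ring M] [Algebra ℂ M] {S : Submonoid M} {a : ℕ}

theorem torsionRightIdeal_mul_span_le :
    torsionRightIdeal S a * Submodule.span ℂ (S : Set M) ≤ torsionRightIdeal S a := by
  rw [torsionRightIdeal, Submodule.span_mul_span, Submodule.span_le]
  rintro _ ⟨_, ⟨x, hx, y, hy, rfl⟩, s, hs, rfl⟩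
  exact Submodule.subset_span ⟨x, hx, y * s, S.mul_mem hy hs, mul_assoc _ _ _⟩

theorem torsionRightIdeal_le_span : torsionRightIdeal S a ≤ Submodule.span ℂ (S : Set M) := by
  rw [torsionRightIdeal, Submodule.span_le]
  rintro _ ⟨x, hx, y, hy, rfl⟩
  exact mul_mem_span (sub_mem (Submodule.subset_span (S.pow_mem hx _))
    (Submodule.subset_span (S.pow_mem hx _))) (Submodule.subset_span hy)

theorem span_mul_span_self_le : Submodule.span ℂ (S : Set M) * Submodule.span ℂ (S : Set M) ≤
    Submodule.span ℂ (S : Set M) :=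
  Submodule.mul_le.2 fun _ hx _ hy => mul_mem_span hx hy

theorem torsionIdeal_le_span : torsionIdeal S a ≤ Submodule.span ℂ (S : Set M) :=
  (mul_le_mul' le_rfl torsionRightIdeal_le_span).trans span_mul_span_self_le

theorem isStable_torsionIdeal : IsStable S (torsionIdeal S a) := by
  intro s hs x hx
  have hs' : s ∈ Submodule.span ℂ (S : Set M) := Submodule.subset_span hs
  constructor
  · have h := Submodule.mul_mem_mul hs' hx
    rw [torsionIdeal, ← mul_assoc] at h
    exact mul_le_mul' span_mul_span_self_le le_rfl h
  · have h := Submodule.mul_mem_mul hx hs'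
    rw [torsionIdeal, mul_assoc] at h
    exact mul_le_mul' le_rfl torsionRightIdeal_mul_span_le h

theorem torsionRightIdeal_le_torsionIdeal : torsionRightIdeal S a ≤ torsionIdeal S a := by
  intro x hx
  have := Submodule.mul_mem_mul (Submodule.subset_span (R := ℂ) S.one_mem) hx
  rwa [one_mul] at this

theorem pow_sub_pow_mem_torsionIdeal {x : M} (hx : x ∈ S) :
    x ^ (2 * a) - x ^ a ∈ torsionIdeal S a :=
  torsionRightIdeal_le_torsionIdeal
    (Submodule.subset_span ⟨x, hx, 1, S.one_mem, (mul_one _).symm⟩)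

/-- The right ideal absorbs every inner copy of the span, so only the leftmost one survives. -/
theorem torsionIdeal_pow_le (k : ℕ) :
    torsionIdeal S a ^ k ≤ Submodule.span ℂ (S : Set M) * torsionRightIdeal S a ^ k := by
  induction k with
  | zero =>
    rw [pow_zero, pow_zero, mul_one, Submodule.one_le]
    exact Submodule.subset_span S.one_mem
  | succ k ih =>
    rcases Nat.eq_zero_or_pos k with rfl | hk
    · simp [torsionIdeal]
    · have h1 : torsionRightIdeal S a ^ k * Submodule.span ℂ (S : Set M) ≤
          torsionRightIdeal S a ^ k := by
        obtain ⟨j, rfl⟩ := Nat.exists_eq_succ_of_ne_zero hk.ne'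
        rw [pow_succ, mul_assoc]
        exact mul_le_mul' le_rfl torsionRightIdeal_mul_span_le
      calc torsionIdeal S a ^ (k + 1) = torsionIdeal S a ^ k * torsionIdeal S a := pow_succ _ _
        _ ≤ (Submodule.span ℂ (S : Set M) * torsionRightIdeal S a ^ k) * torsionIdeal S a :=
            mul_le_mul' ih le_rfl
        _ = Submodule.span ℂ (S : Set M) * (torsionRightIdeal S a ^ k *
              Submodule.span ℂ (S : Set M)) * torsionRightIdeal S a := by
            rw [torsionIdeal]; simp only [mul_assoc]
        _ ≤ Submodule.span ℂ (S : Set M) * torsionRightIdeal S a ^ k * torsionRightIdeal S a :=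
            mul_le_mul' (mul_le_mul' le_rfl h1) le_rfl
        _ = _ := by rw [pow_succ, mul_assoc]

/-- The k-th power is spanned by k-fold products of generators, which are exactly the products in
the identity. -/
theorem torsionRightIdeal_pow_eq_bot_iff (k : ℕ) :
    torsionRightIdeal S a ^ k = ⊥ ↔ ∀ X Y : Fin k → M, (∀ i, X i ∈ S) → (∀ i, Y i ∈ S) →
      (List.ofFn fun i : Fin k => (X i ^ (2 * a) - X i ^ a) * Y i).prod = 0 := by
  rw [torsionRightIdeal, Submodule.span_pow, Submodule.span_eq_bot]
  constructor
  · intro h X Y hX hY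
    exact h _ (Set.mem_pow.2 ⟨fun i => ⟨_, X i, hX i, Y i, hY i, rfl⟩, rfl⟩)
  · intro h z hz
    obtain ⟨f, rfl⟩ := Set.mem_pow.1 hz
    choose X hX Y hY hXY using fun i => (f i).2
    simp_rw [hXY]
    exact h X Y hX hY

theorem torsionIdeal_pow_eq_bot_iff (k : ℕ) :
    torsionIdeal S a ^ k = ⊥ ↔ torsionRightIdeal S a ^ k = ⊥ := by
  constructor
  · intro h
    rw [eq_bot_iff, ← h]
    exact pow_le_pow_left' torsionRightIdeal_le_torsionIdeal k
  · intro h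
    rw [eq_bot_iff]
    refine (torsionIdeal_pow_le k).trans ?_
    rw [h, Submodule.mul_bot]

end TorsionIdeal

section TameSemigroup

variable {d m : ℕ} {A : Fin m → Matrix (Fin d) (Fin d) ℂ}

theorem satisfiesIdentity_iff (k : ℕ) : SatisfiesIdentity A k ↔
    ∃ a : ℕ, 0 < a ∧ torsionIdeal (semigroup A) a ^ k = ⊥ := by
  simp_rw [SatisfiesIdentity, torsionIdeal_pow_eq_bot_iff, torsionRightIdeal_pow_eq_bot_iff]

/-- A tame finitely generated matrix semigroup satisfies some identity. -/
theorem exists_satisfiesIdentity (htame : ∀ X ∈ semigroup A, IsTame X) :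
    ∃ k, SatisfiesIdentity A k := by
  obtain ⟨a, ha, hpow⟩ :=
    (finiteModulo_traceRadical (finite_trace_image A htame)).exists_pow_sub_pow_mem isStable_traceRadical
  obtain ⟨k, hk⟩ := isNilpotent_traceRadical (S := semigroup A)
  refine ⟨k, a, ha, (torsionRightIdeal_pow_eq_bot_iff k).1 ?_⟩
  rw [eq_bot_iff, ← Submodule.zero_eq_bot, ← hk]
  refine pow_le_pow_left' (Submodule.span_le.2 ?_) k
  rintro _ ⟨x, hx, y, hy, rfl⟩
  exact (isStable_traceRadical y hy _ (hpow x hx)).2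

/-- A tame finitely generated matrix semigroup is finite modulo each of its torsion ideals. -/
theorem finiteModulo_torsionIdeal (htame : ∀ X ∈ semigroup A, IsTame X) {a : ℕ} (ha : 0 < a) :
    FiniteModulo (semigroup A) (torsionIdeal (semigroup A) a) :=
  FiniteModulo.of_isNilpotent (A := A) rfl isStable_traceRadical traceRadical_le
    isStable_torsionIdeal torsionIdeal_le_span isNilpotent_traceRadical
    (finiteModulo_traceRadical (finite_trace_image A htame)) ha
    fun _ hv => pow_sub_pow_mem_torsionIdeal hv

end TameSemigroup

/-! ### Norm comparison and submultiplicativity of the maximal norms. -/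

/-- On a finite-dimensional space every seminorm is dominated by every norm. -/
theorem exists_seminorm_le_mul {E : Type*} [AddCommGroup E] [Module ℂ E] [FiniteDimensional ℂ E]
    (N N' : Seminorm ℂ E) (hN : ∀ x, N x = 0 → x = 0) :
    ∃ C : ℝ, 0 < C ∧ ∀ x, N' x ≤ C * N x := by
  let instN : NormedAddCommGroup E := AddGroupNorm.toNormedAddCommGroup
    { toFun := N
      map_zero' := map_zero N
      add_le' := map_add_le_add N
      neg' := map_neg_eq_map N
      eq_zero_of_map_eq_zero' := hN }
  let instS : NormedSpace ℂ E := { norm_smul_le := fun c x => (map_smul_eq_mul N c x).le }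
  let b := Module.finBasis ℂ E
  let φ : ∀ i, E →L[ℂ] ℂ := fun i => LinearMap.toContinuousLinearMap (b.coord i)
  refine ⟨∑ i, ‖φ i‖ * N' (b i) + 1, by positivity, fun x => ?_⟩
  have hx : ‖x‖ = N x := rfl
  calc N' x = N' (∑ i, b.repr x i • b i) := by rw [b.sum_repr]
    _ ≤ ∑ i, N' (b.repr x i • b i) :=
        Finset.le_sum_of_subadditive N' (map_zero N').le (map_add_le_add N') _ _
    _ ≤ ∑ i, ‖φ i‖ * N' (b i) * ‖x‖ := by
        refine Finset.sum_le_sum fun i _ => ?_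
        rw [map_smul_eq_mul]
        have h1 : ‖b.repr x i‖ ≤ ‖φ i‖ * ‖x‖ := (φ i).le_opNorm x
        calc _ ≤ ‖φ i‖ * ‖x‖ * N' (b i) := mul_le_mul_of_nonneg_right h1 (apply_nonneg _ _)
          _ = _ := by ring
    _ = (∑ i, ‖φ i‖ * N' (b i)) * N x := by rw [Finset.sum_mul, hx]
    _ ≤ _ := mul_le_mul_of_nonneg_right (by linarith) (apply_nonneg _ _)

section Norm

variable {d m : ℕ} (N : Seminorm ℂ (Matrix (Fin d) (Fin d) ℂ))

theorem exists_norm_entry_le (hN : ∀ X, N X = 0 → X = 0) :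
    ∃ C : ℝ, 0 < C ∧ ∀ X i j, ‖X i j‖ ≤ C * N X := by
  choose C hC h using fun p : Fin d × Fin d => exists_seminorm_le_mul N
    ((normSeminorm ℂ ℂ).comp (Matrix.entryLinearMap ℂ ℂ p.1 p.2)) hN
  refine ⟨∑ p, C p + 1, by have := Finset.sum_nonneg fun p (_ : p ∈ Finset.univ) => (hC p).le;
                            linarith, fun X i j => (h (i, j) X).trans ?_⟩
  refine mul_le_mul_of_nonneg_right ?_ (apply_nonneg _ _)
  have := Finset.single_le_sum (fun p _ => (hC p).le) (Finset.mem_univ (i, j))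
  linarith

theorem exists_seminorm_mul_le (hN : ∀ X, N X = 0 → X = 0) :
    ∃ C : ℝ, 0 < C ∧ ∀ X Y, N (X * Y) ≤ C * N X * N Y := by
  let inst1 : NormedRing (Matrix (Fin d) (Fin d) ℂ) := Matrix.linftyOpNormedRing
  let inst2 : NormedSpace ℂ (Matrix (Fin d) (Fin d) ℂ) := Matrix.linftyOpNormedSpace
  obtain ⟨C₁, hC₁, h₁⟩ := exists_seminorm_le_mul N
    (normSeminorm ℂ (Matrix (Fin d) (Fin d) ℂ)) hN
  obtain ⟨C₂, hC₂, h₂⟩ := exists_seminorm_le_mul (normSeminorm ℂ (Matrix (Fin d) (Fin d) ℂ)) N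
    fun X hX => norm_eq_zero.1 hX
  have h₁' : ∀ X, ‖X‖ ≤ C₁ * N X := h₁
  have h₂' : ∀ X, N X ≤ C₂ * ‖X‖ := h₂
  refine ⟨C₂ * C₁ * C₁, by positivity, fun X Y => ?_⟩
  calc N (X * Y) ≤ C₂ * ‖X * Y‖ := h₂' _
    _ ≤ C₂ * (‖X‖ * ‖Y‖) := by gcongr; exact norm_mul_le _ _
    _ ≤ C₂ * ((C₁ * N X) * (C₁ * N Y)) := by
        have := mul_le_mul (h₁' X) (h₁' Y) (norm_nonneg Y) (mul_nonneg hC₁.le (apply_nonneg N X))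
        gcongr
    _ = _ := by ring

variable (A : Fin m → Matrix (Fin d) (Fin d) ℂ)

theorem le_maxNorm (l : List (Fin m)) : N (l.map A).prod ≤ maxNorm N A l.length := by
  have h := le_ciSup (f := fun w : Fin l.length → Fin m => N (wordProd A w))
    (Set.finite_range _).bddAbove l.get
  have h2 : wordProd A l.get = (l.map A).prod := by
    exact congrArg List.prod (List.map_ofFn.symm.trans (by rw [List.ofFn_get]))
  rwa [h2] at h

theorem exists_maxNorm_eq (hm : 0 < m) (n : ℕ) :
    ∃ l : List (Fin m), l.length = n ∧ N (l.map A).prod = maxNorm N A n := by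
  have : Nonempty (Fin n → Fin m) := ⟨fun _ => ⟨0, hm⟩⟩
  obtain ⟨w, hw⟩ := exists_eq_ciSup_of_finite (f := fun w : Fin n → Fin m => N (wordProd A w))
  refine ⟨List.ofFn w, by simp, ?_⟩
  rw [List.map_ofFn]
  exact hw

theorem maxNorm_nonneg (n : ℕ) : 0 ≤ maxNorm N A n :=
  Real.iSup_nonneg fun _ => apply_nonneg _ _

variable {N A}

theorem NonDegenerate.pos (hA : NonDegenerate N A) : 0 < m := by
  by_contra h
  obtain rfl : m = 0 := by omega
  obtain ⟨n, hn, hne⟩ := hA 1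
  have : IsEmpty (Fin n → Fin 0) := ⟨fun w => (w ⟨0, hn⟩).elim0⟩
  exact hne (Real.iSup_of_isEmpty _)

theorem maxNorm_add_le (hm : 0 < m) {C : ℝ} (hC : ∀ X Y, N (X * Y) ≤ C * N X * N Y)
    (hC0 : 0 < C) (n r : ℕ) : maxNorm N A (n + r) ≤ C * maxNorm N A n * maxNorm N A r := by
  obtain ⟨l, hl, h⟩ := exists_maxNorm_eq N A hm (n + r)
  rw [← h, ← List.take_append_drop n l, List.map_append, List.prod_append]
  refine (hC _ _).trans ?_
  have h1 := le_maxNorm N A (l.take n)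
  have h2 := le_maxNorm N A (l.drop n)
  rw [List.length_take, hl, min_eq_left (Nat.le_add_right _ _)] at h1
  rw [List.length_drop, hl, Nat.add_sub_cancel_left] at h2
  gcongr
  exact mul_nonneg hC0.le (maxNorm_nonneg N A n)

/-- By submultiplicativity, one vanishing maximum would make all later ones vanish. -/
theorem NonDegenerate.maxNorm_pos (hN : ∀ X, N X = 0 → X = 0) (hA : NonDegenerate N A) (n : ℕ) :
    0 < maxNorm N A n := by
  refine (maxNorm_nonneg N A n).lt_of_ne fun h0 => ?_
  obtain ⟨C, hC0, hC⟩ := exists_seminorm_mul_le N hN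
  obtain ⟨n', hn', hne⟩ := hA n
  have := maxNorm_add_le (A := A) hA.pos hC hC0 n (n' - n)
  rw [Nat.add_sub_cancel' hn', ← h0, mul_zero, zero_mul] at this
  exact hne (le_antisymm this (maxNorm_nonneg N A n'))

theorem NonDegenerate.one_ne_zero (hN : ∀ X, N X = 0 → X = 0) (hA : NonDegenerate N A) :
    (1 : Matrix (Fin d) (Fin d) ℂ) ≠ 0 := by
  intro h
  obtain ⟨l, -, hl⟩ := exists_maxNorm_eq N A hA.pos 0
  have := hA.maxNorm_pos hN 0
  rw [← hl, ← one_mul (l.map A).prod, h, zero_mul, map_zero] at this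
  exact lt_irrefl _ this

/-! ### The upper bound. -/

/-- If the semigroup is finite modulo an ideal `J` with `J ^ k = 0`, then `e * w`, for
`e ∈ J ^ j` and `w` a word, grows at most like a polynomial of degree `k - j - 1`. -/
theorem exists_seminorm_mul_word_le {J : Submodule ℂ (Matrix (Fin d) (Fin d) ℂ)} {k : ℕ}
    (hJ : J ^ k = ⊥) (hfin : FiniteModulo (semigroup A) J)
    (t : ℕ) : ∀ j, t + j = k → ∀ e ∈ J ^ j, ∃ C : ℝ, 0 ≤ C ∧ ∀ l : List (Fin m),
      N (e * (l.map A).prod) ≤ C * (t * ((l.length : ℝ) + 1) ^ (t - 1)) := by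
  have hAmem : ∀ i, A i ∈ semigroup A := fun i => Submonoid.subset_closure ⟨i, rfl⟩
  induction t with
  | zero =>
    -- Here e = 0; the factor `t` in the bound makes the right-hand side 0, where the truncated
    -- exponent alone would not.
    intro j hj e he
    rw [zero_add] at hj
    rw [hj, hJ, Submodule.mem_bot] at he
    exact ⟨0, le_rfl, fun l => by simp [he]⟩
  | succ t ih =>
    intro j hj e he
    obtain ⟨T, hT, hTS, hr⟩ := hfin
    choose! g hgT hg using hr
    -- The finitely many errors that occur when the identity, or a representative times a generator,
    -- is replaced by its own representative. All lie in J^(j+1), where the induction hypothesis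
    -- applies.
    let F : Set (Matrix (Fin d) (Fin d) ℂ) :=
      insert (e * (1 - g 1)) ((fun p : Matrix (Fin d) (Fin d) ℂ × Fin m =>
        e * (p.1 * A p.2 - g (p.1 * A p.2))) '' (T ×ˢ Set.univ))
    have hF : F.Finite := ((hT.prod Set.finite_univ).image _).insert _
    have hFJ : ∀ x ∈ F, x ∈ J ^ (j + 1) := by
      intro x hx
      rw [pow_succ]
      rcases hx with rfl | ⟨⟨r, i⟩, ⟨hrT, -⟩, rfl⟩
      · exact Submodule.mul_mem_mul he (hg 1 (Submonoid.one_mem _))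
      · exact Submodule.mul_mem_mul he (hg _ (Submonoid.mul_mem _ (hTS hrT) (hAmem i)))
    choose! C hC0 hC using fun x hx => ih (j + 1) (by omega) x (hFJ x hx)
    obtain ⟨C', hC'⟩ := (hF.image C).bddAbove
    have hCle : ∀ x ∈ F, C x ≤ C' := fun x hx => hC' ⟨x, hx, rfl⟩
    have hC'0 : 0 ≤ C' := (hC0 _ (Set.mem_insert _ _)).trans (hCle _ (Set.mem_insert _ _))
    obtain ⟨K, hK⟩ := (hT.image fun r => N (e * r)).bddAbove
    have hKle : ∀ r ∈ T, N (e * r) ≤ K := fun r hr => hK ⟨r, hr, rfl⟩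
    have hg1 : g 1 ∈ T := hgT 1 (Submonoid.one_mem _)
    have hK0 : 0 ≤ K := (apply_nonneg _ _).trans (hKle _ hg1)
    have hFb : ∀ x ∈ F, ∀ (n : ℕ) (l : List (Fin m)), l.length ≤ n →
        N (x * (l.map A).prod) ≤ C' * (t * ((n : ℝ) + 1) ^ (t - 1)) := by
      intro x hx n l hl
      refine (hC x hx l).trans ?_
      have : (l.length : ℝ) ≤ n := by exact_mod_cast hl
      gcongr
      exact hCle x hx
    -- One error per letter, multiplied by the rest of the word; `n` bounds all these remainders
    -- uniformly.
    have hword : ∀ (n : ℕ) (l : List (Fin m)), l.length ≤ n → ∀ r ∈ T,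
        N (e * r * (l.map A).prod) ≤ K + l.length * (C' * (t * ((n : ℝ) + 1) ^ (t - 1))) := by
      intro n l
      induction l with
      | nil => intro _ r hr; simpa using hKle r hr
      | cons i l ihl =>
        intro hl r hr
        have hl' : l.length ≤ n := (Nat.le_succ _).trans hl
        have hrA : r * A i ∈ semigroup A := Submonoid.mul_mem _ (hTS hr) (hAmem i)
        have h1 := ihl hl' _ (hgT _ hrA)
        have h2 := hFb _ (Set.mem_insert_of_mem _ ⟨(r, i), ⟨hr, trivial⟩, rfl⟩) n l hl'
        have h3 : e * r * ((i :: l).map A).prod = e * g (r * A i) * (l.map A).prod +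
            e * (r * A i - g (r * A i)) * (l.map A).prod := by
          rw [List.map_cons, List.prod_cons]; noncomm_ring
        rw [h3]
        refine (map_add_le_add N _ _).trans ?_
        rw [List.length_cons]
        push_cast
        linarith
    refine ⟨K + 2 * (C' * t), by positivity, fun l => ?_⟩
    have h1 := hword l.length l le_rfl _ hg1
    have h2 := hFb _ (Set.mem_insert _ _) l.length l le_rfl
    have h3 : e * (l.map A).prod = e * g 1 * (l.map A).prod + e * (1 - g 1) * (l.map A).prod := by
      noncomm_ring
    set n : ℝ := (l.length : ℝ) with hn
    have hn0 : 0 ≤ n := Nat.cast_nonneg _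
    have hpow : t * (n + 1) ^ (t - 1) * (n + 1) = t * (n + 1) ^ t := by
      rcases Nat.eq_zero_or_pos t with rfl | ht
      · simp
      · rw [mul_assoc, ← pow_succ, Nat.sub_add_cancel ht]
    have hone : 1 ≤ (n + 1) ^ t := one_le_pow₀ (by linarith)
    calc N (e * (l.map A).prod) ≤ K + n * (C' * (t * (n + 1) ^ (t - 1))) +
          C' * (t * (n + 1) ^ (t - 1)) := by
          rw [h3]; exact (map_add_le_add N _ _).trans (add_le_add h1 h2)
      _ = K + C' * (t * (n + 1) ^ (t - 1) * (n + 1)) := by ring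
      _ = K + C' * t * (n + 1) ^ t := by rw [hpow]; ring
      _ ≤ K * (n + 1) ^ t + 2 * (C' * t) * (n + 1) ^ t := by
          have : 0 ≤ C' * t * (n + 1) ^ t := by positivity
          nlinarith
      _ = (K + 2 * (C' * t)) * (1 * (n + 1) ^ t) := by ring
      _ ≤ (K + 2 * (C' * t)) * (((t + 1 : ℕ) : ℝ) * (n + 1) ^ (t + 1 - 1)) := by
          rw [Nat.add_sub_cancel]
          gcongr
          push_cast
          linarith [(Nat.cast_nonneg t : (0 : ℝ) ≤ t)]

theorem exists_maxNorm_le (hm : 0 < m) {J : Submodule ℂ (Matrix (Fin d) (Fin d) ℂ)} {k : ℕ}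
    (hJ : J ^ k = ⊥) (hfin : FiniteModulo (semigroup A) J) :
    ∃ C : ℝ, 0 < C ∧ ∀ n : ℕ, 1 ≤ n → maxNorm N A n ≤ C * (n : ℝ) ^ (k - 1) := by
  obtain ⟨C, hC0, hC⟩ := exists_seminorm_mul_word_le (N := N) hJ hfin k 0 (add_zero k) 1
    (by rw [pow_zero]; exact Submodule.one_le.1 le_rfl)
  refine ⟨C * k * 2 ^ (k - 1) + 1, by positivity, fun n hn => ?_⟩
  obtain ⟨l, hl, h⟩ := exists_maxNorm_eq N A hm n
  have h1 := hC l
  rw [one_mul, h, hl] at h1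
  have hn' : (1 : ℝ) ≤ n := by exact_mod_cast hn
  calc maxNorm N A n ≤ C * (k * ((n : ℝ) + 1) ^ (k - 1)) := h1
    _ ≤ C * (k * (2 * (n : ℝ)) ^ (k - 1)) := by gcongr; linarith
    _ = C * k * 2 ^ (k - 1) * (n : ℝ) ^ (k - 1) := by rw [mul_pow]; ring
    _ ≤ _ := by gcongr; linarith

end Norm

/-! ### Powers modulo the square of the torsion ideal. -/

section Algebra

variable {M : Type*} [Ring M] [Algebra ℂ M] {S : Submonoid M} {a : ℕ}

/-- Exchanging the factors one at a time: each exchange contributes an element of J^2 next to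
elements of `J`, hence gains one power of `J`. -/
theorem list_prod_mem_pow_and_sub_mem {ι : Type*} {J : Submodule ℂ M} (x z : ι → M)
    (hx : ∀ i, x i ∈ J) (hxz : ∀ i, x i - z i ∈ J ^ 2) (hz : ∀ i, z i ∈ J) (l : List ι) :
    (l.map z).prod ∈ J ^ l.length ∧ (l.map x).prod - (l.map z).prod ∈ J ^ (l.length + 1) := by
  induction l with
  | nil => exact ⟨by simpa using Submodule.one_le.1 (le_refl (1 : Submodule ℂ M)), by simp⟩
  | cons i l ih =>
    simp only [List.map_cons, List.prod_cons, List.length_cons]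
    refine ⟨by rw [pow_succ']; exact Submodule.mul_mem_mul (hz i) ih.1, ?_⟩
    rw [show x i * (l.map x).prod - z i * (l.map z).prod =
      x i * ((l.map x).prod - (l.map z).prod) + (x i - z i) * (l.map z).prod by noncomm_ring]
    refine add_mem ?_ ?_
    · rw [pow_succ']; exact Submodule.mul_mem_mul (hx i) ih.2
    · rw [show l.length + 1 + 1 = 2 + l.length by ring, pow_add]
      exact Submodule.mul_mem_mul (hxz i) ih.1

theorem list_prod_map_smul {ι : Type*} (c : ℂ) (w : ι → M) (l : List ι) :
    (l.map fun i => c • w i).prod = c ^ l.length • (l.map w).prod := by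
  induction l with
  | nil => simp
  | cons i l ih =>
    rw [List.map_cons, List.prod_cons, ih, smul_mul_smul_comm, List.map_cons, List.prod_cons,
      List.length_cons, pow_succ']

theorem pow_sub_pow_mem_torsionIdeal_of_le {x : M} (hx : x ∈ S) (l : ℕ) {c : ℕ} (hc : a ≤ c) :
    x ^ (c + a * l) - x ^ c ∈ torsionIdeal S a :=
  pow_add_mul_sub_mem isStable_torsionIdeal hx
    (by rw [← two_mul]; exact pow_sub_pow_mem_torsionIdeal hx) l hc

/-- If `z = x ^ (a * (j * c))` then `z * (z - 1) ^ j` lies in the `j`-th power of the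
torsion ideal. -/
theorem pow_mul_sub_one_pow_mem {x : M} (hx : x ∈ S) {j c : ℕ} (hc : 0 < c) :
    x ^ (a * (j * c)) * (x ^ (a * (j * c)) - 1) ^ j ∈ torsionIdeal S a ^ j := by
  have h1 : x ^ (a * c + a * (j * c)) - x ^ (a * c) ∈ torsionIdeal S a :=
    pow_sub_pow_mem_torsionIdeal_of_le hx _ (Nat.le_mul_of_pos_right a hc)
  -- The leading power is (x^(ac))^j, so one copy of x^(ac) goes to each of the `j` factors.
  have h2 : x ^ (a * (j * c)) * (x ^ (a * (j * c)) - 1) ^ j =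
      (x ^ (a * c + a * (j * c)) - x ^ (a * c)) ^ j := by
    have h3 : x ^ (a * c + a * (j * c)) - x ^ (a * c) =
        x ^ (a * c) * (x ^ (a * (j * c)) - 1) := by rw [mul_sub, mul_one, pow_add]
    have h4 : Commute (x ^ (a * c)) (x ^ (a * (j * c)) - 1) :=
      (Commute.pow_pow_self x _ _).sub_right (Commute.one_right _)
    rw [h3, h4.mul_pow, ← pow_mul]
    congr 2
    ring
  rw [h2]
  exact Submodule.pow_mem_pow _ h1 j

/-- The hypothesis says that multiplication by z fixes z^2 - z modulo J^2, so the powers of z form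
an arithmetic progression there. -/
theorem pow_sub_smul_mem_sq {J : Submodule ℂ M} (hJ : IsStable S (J ^ 2)) {z : M} (hz : z ∈ S)
    (h : z * (z - 1) ^ 2 ∈ J ^ 2) (n : ℕ) :
    z ^ (n + 1) - z - (n : ℂ) • (z ^ 2 - z) ∈ J ^ 2 := by
  induction n with
  | zero => simp
  | succ n ih =>
    have h1 := add_mem (hJ z hz _ ih).1 ((J ^ 2).smul_mem (n : ℂ) h)
    convert h1 using 1
    have h2 : z * (z - 1) ^ 2 = z * (z ^ 2 - z) - (z ^ 2 - z) := by noncomm_ring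
    rw [h2, Nat.cast_succ, add_smul, one_smul]
    simp only [mul_sub, smul_sub, mul_smul_comm, pow_succ' z (n + 1), pow_two]
    abel

theorem pow_two_mul_sub_pow_sub_smul_mem_sq {J : Submodule ℂ M} (hJ : IsStable S (J ^ 2)) {z : M}
    (hz : z ∈ S) (h : z * (z - 1) ^ 2 ∈ J ^ 2) (n : ℕ) :
    z ^ (n + 1) * z ^ (n + 1) - z ^ (n + 1) - ((n : ℂ) + 1) • (z ^ 2 - z) ∈ J ^ 2 := by
  have h1 := sub_mem (pow_sub_smul_mem_sq hJ hz h (2 * n + 1)) (pow_sub_smul_mem_sq hJ hz h n)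
  convert h1 using 1
  rw [← pow_add, show n + 1 + (n + 1) = 2 * n + 1 + 1 by ring,
    show ((n : ℂ) + 1) = ((2 * n + 1 : ℕ) : ℂ) - (n : ℂ) by push_cast; ring, sub_smul]
  abel

/-- Products of `k` differences of powers that survive modulo the `(k + 1)`-st power of the
torsion ideal grow like `n ^ k`. -/
theorem prod_pow_sub_pow_eq_smul {k : ℕ} (hJ : torsionIdeal S a ^ (k + 1) = ⊥) {b c : ℕ}
    (hb : b = a * (2 * c)) (hc : 0 < c) (X Y : Fin k → M) (hX : ∀ i, X i ∈ S) (hY : ∀ i, Y i ∈ S)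
    (n : ℕ) :
    (List.ofFn fun i => ((X i ^ b) ^ (n + 1) * (X i ^ b) ^ (n + 1) - (X i ^ b) ^ (n + 1)) *
      Y i).prod = ((n : ℂ) + 1) ^ k •
        (List.ofFn fun i => (X i ^ (2 * b) - X i ^ b) * Y i).prod := by
  have hst : IsStable S (torsionIdeal S a) := isStable_torsionIdeal
  have hst2 : IsStable S (torsionIdeal S a ^ 2) := by rw [pow_two]; exact hst.mul hst
  have hbpow : ∀ (i : Fin k) (r : ℕ),
      (X i ^ b) ^ (r + 1) * (X i ^ b) ^ (r + 1) - (X i ^ b) ^ (r + 1) ∈ torsionIdeal S a := by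
    intro i r
    rw [← pow_add, ← pow_mul, ← pow_mul,
      show b * (r + 1 + (r + 1)) = b * (r + 1) + a * ((2 * c) * (r + 1)) by rw [hb]; ring]
    refine pow_sub_pow_mem_torsionIdeal_of_le (hX i) _ ?_
    rw [hb, mul_assoc]
    exact Nat.le_mul_of_pos_right a (by positivity)
  have hw : ∀ i : Fin k, (X i ^ (2 * b) - X i ^ b) * Y i ∈ torsionIdeal S a := by
    intro i
    have := hbpow i 0
    rw [zero_add, pow_one, ← pow_add, ← two_mul] at this
    exact (hst _ (hY i) _ this).2
  have hkey := list_prod_mem_pow_and_sub_mem (J := torsionIdeal S a)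
    (fun i => ((X i ^ b) ^ (n + 1) * (X i ^ b) ^ (n + 1) - (X i ^ b) ^ (n + 1)) * Y i)
    (fun i => ((n : ℂ) + 1) • ((X i ^ (2 * b) - X i ^ b) * Y i))
    (fun i => (hst _ (hY i) _ (hbpow i n)).2)
    (fun i => by
      -- The factor 2 in `b` is what allows j = 2 here.
      have h1 : X i ^ b * (X i ^ b - 1) ^ 2 ∈ torsionIdeal S a ^ 2 := by
        rw [hb]; exact pow_mul_sub_one_pow_mem (hX i) hc
      have h2 := (hst2 _ (hY i) _ (pow_two_mul_sub_pow_sub_smul_mem_sq hst2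
        (S.pow_mem (hX i) b) h1 n)).2
      rw [sub_mul, smul_mul_assoc, ← pow_mul (X i) b 2, mul_comm b 2] at h2
      exact h2)
    (fun i => Submodule.smul_mem _ _ (hw i)) (List.finRange k)
  have h3 := hkey.2
  rw [List.length_finRange, hJ, Submodule.mem_bot, sub_eq_zero, list_prod_map_smul,
    List.length_finRange] at h3
  rw [List.ofFn_eq_map, List.ofFn_eq_map]
  exact h3

end Algebra

/-! ### Families of words with polynomial entries. -/

section Polynomial

open Polynomial

theorem exists_mul_pow_le_norm_eval (s : ℕ) : ∀ p : ℂ[X], p ≠ 0 → s ≤ p.natDegree →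
    ∃ c : ℝ, 0 < c ∧ ∀ᶠ n : ℕ in atTop, c * (n : ℝ) ^ s ≤ ‖p.eval (n : ℂ)‖ := by
  induction s with
  | zero =>
    intro p hp _
    by_cases hdeg : 0 < p.degree
    · refine ⟨1, one_pos, ?_⟩
      have := p.tendsto_norm_atTop hdeg (l := atTop) (z := fun n : ℕ => (n : ℂ))
        (by simpa using tendsto_natCast_atTop_atTop)
      simpa using this.eventually_ge_atTop 1
    · rw [eq_C_of_degree_le_zero (not_lt.1 hdeg)] at hp ⊢
      exact ⟨‖p.coeff 0‖, norm_pos_iff.2 fun h => hp (by rw [h, C_0]), by simp⟩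
  | succ s ih =>
    intro p hp hs
    have hq : p.divX ≠ 0 := fun h => by
      rw [divX_eq_zero_iff.1 h, natDegree_C] at hs
      omega
    obtain ⟨c, hc, hev⟩ := ih p.divX hq (by rw [natDegree_divX_eq_natDegree_tsub_one]; omega)
    -- Half of the growth of X * `p.divX` absorbs the constant coefficient.
    refine ⟨c / 2, by positivity, ?_⟩
    have hbig : ∀ᶠ n : ℕ in atTop, ‖p.coeff 0‖ ≤ c / 2 * n :=
      (tendsto_natCast_atTop_atTop.const_mul_atTop (by positivity)).eventually_ge_atTop _
    filter_upwards [hev, hbig, eventually_ge_atTop 1] with n h1 h2 hn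
    have hn' : (1 : ℝ) ≤ n := by exact_mod_cast hn
    have h3 : p.eval (n : ℂ) = p.divX.eval (n : ℂ) * n + p.coeff 0 := by
      conv_lhs => rw [← divX_mul_X_add p]
      simp
    have h4 : ‖p.divX.eval (n : ℂ)‖ * n - ‖p.coeff 0‖ ≤ ‖p.eval (n : ℂ)‖ := by
      rw [h3]
      have := norm_sub_le_norm_add (p.divX.eval (n : ℂ) * n) (p.coeff 0)
      rwa [norm_mul, Complex.norm_natCast] at this
    have h5 : (1 : ℝ) ≤ (n : ℝ) ^ s := one_le_pow₀ hn'
    have h6 : c / 2 * n ≤ c / 2 * (n : ℝ) ^ s * n := by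
      have : 0 ≤ c / 2 * n := by positivity
      nlinarith
    have h7 : c * (n : ℝ) ^ s * n ≤ ‖p.divX.eval (n : ℂ)‖ * n := by gcongr
    rw [pow_succ]
    nlinarith

variable {d m : ℕ} (A : Fin m → Matrix (Fin d) (Fin d) ℂ)

/-- Evaluation of a matrix of polynomials at a natural number. -/
noncomputable def evalNat (n : ℕ) : Matrix (Fin d) (Fin d) ℂ[X] →+* Matrix (Fin d) (Fin d) ℂ :=
  (evalRingHom (n : ℂ)).mapMatrix

theorem evalNat_apply (n : ℕ) (P : Matrix (Fin d) (Fin d) ℂ[X]) (i j : Fin d) :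
    evalNat n P i j = (P i j).eval (n : ℂ) := rfl

/-- The entries of `f n` are polynomials in `n`, and `f n` is a product of `L * n + c` of the
given matrices, for some `c`. -/
def IsPolynomialWord (L : ℕ) (f : ℕ → Matrix (Fin d) (Fin d) ℂ) : Prop :=
  (∃ c : ℕ, ∀ n, ∃ l : List (Fin m), l.length = L * n + c ∧ (l.map A).prod = f n) ∧
    ∃ P : Matrix (Fin d) (Fin d) ℂ[X], ∀ n, f n = evalNat n P

variable {A}

theorem IsPolynomialWord.mul {L L' : ℕ} {f g : ℕ → Matrix (Fin d) (Fin d) ℂ}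
    (hf : IsPolynomialWord A L f) (hg : IsPolynomialWord A L' g) :
    IsPolynomialWord A (L + L') (f * g) := by
  obtain ⟨⟨c, hf⟩, P, hP⟩ := hf
  obtain ⟨⟨c', hg⟩, Q, hQ⟩ := hg
  refine ⟨⟨c + c', fun n => ?_⟩, P * Q, fun n => by rw [Pi.mul_apply, hP, hQ, map_mul]⟩
  obtain ⟨l, hl, hlf⟩ := hf n
  obtain ⟨l', hl', hlg⟩ := hg n
  exact ⟨l ++ l', by rw [List.length_append, hl, hl']; ring,
    by rw [List.map_append, List.prod_append, hlf, hlg, Pi.mul_apply]⟩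

theorem isPolynomialWord_const {Y : Matrix (Fin d) (Fin d) ℂ} (hY : Y ∈ semigroup A) :
    IsPolynomialWord A 0 fun _ => Y := by
  obtain ⟨l, rfl⟩ := exists_list_of_mem_closure_range hY
  refine ⟨⟨l.length, fun n => ⟨l, by simp, rfl⟩⟩, (C : ℂ →+* ℂ[X]).mapMatrix (l.map A).prod,
    fun n => ?_⟩
  ext i j
  rw [evalNat_apply]
  simp

/-- Expand Z(1 + (Z - 1))^n: the terms with j ≥ k vanish, and each binomial coefficient is a
polynomial in n. The extra factor Z accounts for the exponent n + 1. -/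
theorem exists_evalNat_pow {Z : Matrix (Fin d) (Fin d) ℂ} {k : ℕ} (hZ : Z * (Z - 1) ^ k = 0) :
    ∃ P : Matrix (Fin d) (Fin d) ℂ[X], ∀ n, Z ^ (n + 1) = evalNat n P := by
  let B : ℕ → Matrix (Fin d) (Fin d) ℂ := fun j => Z * (Z - 1) ^ j
  have hB : ∀ j, k ≤ j → B j = 0 := fun j hj => by
    simp only [B]
    rw [← Nat.add_sub_cancel' hj, pow_add, ← mul_assoc, hZ, zero_mul]
  refine ⟨∑ j ∈ Finset.range k, Matrix.of fun i i' =>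
    C (((j.factorial : ℂ)⁻¹) * B j i i') * descPochhammer ℂ j, fun n => ?_⟩
  have h1 : Z ^ (n + 1) = ∑ j ∈ Finset.range (n + 1), (n.choose j : ℂ) • B j := by
    have h2 : Z ^ n = ∑ j ∈ Finset.range (n + 1), (Z - 1) ^ j * 1 ^ (n - j) * (n.choose j) := by
      rw [← (Commute.one_right (Z - 1)).add_pow, sub_add_cancel]
    rw [pow_succ', h2, Finset.mul_sum]
    refine Finset.sum_congr rfl fun j _ => ?_
    rw [one_pow, mul_one, ← mul_assoc, Nat.cast_smul_eq_nsmul, nsmul_eq_mul]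
    exact (Nat.cast_commute _ _).symm.eq
  have h3 : Z ^ (n + 1) = ∑ j ∈ Finset.range k, (n.choose j : ℂ) • B j := by
    rw [h1]
    rcases le_total (n + 1) k with h | h
    · refine Finset.sum_subset (Finset.range_mono h) fun j _ hj => ?_
      rw [Nat.choose_eq_zero_of_lt (by simpa using hj), Nat.cast_zero, zero_smul]
    · refine (Finset.sum_subset (Finset.range_mono h) fun j _ hj => ?_).symm
      rw [hB j (by simpa using hj), smul_zero]
  rw [h3, map_sum]
  refine Finset.sum_congr rfl fun j _ => ?_
  ext i i'
  rw [evalNat_apply, Matrix.of_apply, eval_mul, eval_C, descPochhammer_eval_eq_descFactorial,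
    Nat.descFactorial_eq_factorial_mul_choose, Matrix.smul_apply, smul_eq_mul]
  have : (j.factorial : ℂ) ≠ 0 := Nat.cast_ne_zero.2 j.factorial_ne_zero
  push_cast
  field_simp

theorem isPolynomialWord_pow {l : List (Fin m)} {b k : ℕ}
    (h : (l.map A).prod ^ b * ((l.map A).prod ^ b - 1) ^ k = 0) :
    IsPolynomialWord A (l.length * b) fun n => ((l.map A).prod ^ b) ^ (n + 1) := by
  refine ⟨⟨l.length * b, fun n => ⟨(List.replicate (b * (n + 1)) l).flatten, ?_, ?_⟩⟩,
    exists_evalNat_pow h⟩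
  · simp [List.length_flatten]; ring
  · simp only [← pow_mul]
    induction b * (n + 1) with
    | zero => simp
    | succ r ih => rw [List.replicate_succ, List.flatten_cons, List.map_append, List.prod_append,
        ih, pow_succ']

variable (A) in
/-- The semigroup of matrix functions with polynomial entries whose values are words of lengths
tending to infinity along an arithmetic progression. -/
def polynomialWords : Subsemigroup (ℕ → Matrix (Fin d) (Fin d) ℂ) where
  carrier := {f | ∃ L, 1 ≤ L ∧ IsPolynomialWord A L f}
  mul_mem' := fun ⟨L, hL, hf⟩ ⟨L', _, hg⟩ => ⟨L + L', by omega, hf.mul hg⟩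

theorem pow_sub_pow_mul_mem_closure {X Y : Matrix (Fin d) (Fin d) ℂ} (hX : X ∈ semigroup A)
    (hY : Y ∈ semigroup A) {b k : ℕ} (hb : 0 < b) (h : X ^ b * (X ^ b - 1) ^ k = 0) :
    (fun n => ((X ^ b) ^ (n + 1) * (X ^ b) ^ (n + 1) - (X ^ b) ^ (n + 1)) * Y) ∈
      NonUnitalSubring.closure (polynomialWords A : Set (ℕ → Matrix (Fin d) (Fin d) ℂ)) := by
  obtain ⟨l, rfl⟩ := exists_list_of_mem_closure_range hX
  rcases Nat.eq_zero_or_pos l.length with hl | hl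
  · rw [List.length_eq_zero_iff.1 hl]
    convert zero_mem (NonUnitalSubring.closure
      (polynomialWords A : Set (ℕ → Matrix (Fin d) (Fin d) ℂ))) using 1
    ext1 n
    simp
  · have hL : 1 ≤ l.length * b := Nat.mul_pos hl hb
    have hf := isPolynomialWord_pow h
    have hmem : ∀ f ∈ polynomialWords A, f ∈ NonUnitalSubring.closure
        (polynomialWords A : Set (ℕ → Matrix (Fin d) (Fin d) ℂ)) :=
      fun f hf => NonUnitalSubring.subset_closure hf
    convert sub_mem (hmem _ ⟨_, by omega, (hf.mul hf).mul (isPolynomialWord_const hY)⟩)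
      (hmem _ ⟨_, by omega, hf.mul (isPolynomialWord_const hY)⟩) using 1
    ext1 n
    simp [sub_mul]

theorem list_prod_mem_of_ne_nil {R : Type*} [Ring R] (T : NonUnitalSubring R) {l : List R}
    (hl : l ≠ []) (h : ∀ x ∈ l, x ∈ T) : l.prod ∈ T := by
  induction l with
  | nil => exact absurd rfl hl
  | cons x l ih =>
    rcases eq_or_ne l [] with rfl | hne
    · simpa using h x (by simp)
    · rw [List.prod_cons]
      exact T.mul_mem (h x (by simp)) (ih hne fun y hy => h y (by simp [hy]))

/-- If the subring generated by polynomial words contains a function growing exactly like `n ^ s`,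
then some polynomial word has an entry of degree at least `s`. -/
theorem exists_natDegree_le_of_mem_closure {s : ℕ} {W : Matrix (Fin d) (Fin d) ℂ} (hW : W ≠ 0)
    (h : (fun n : ℕ => ((n : ℂ) + 1) ^ s • W) ∈
      NonUnitalSubring.closure (polynomialWords A : Set (ℕ → Matrix (Fin d) (Fin d) ℂ))) :
    ∃ L c : ℕ, 1 ≤ L ∧ ∃ P : Matrix (Fin d) (Fin d) ℂ[X],
      (∀ n, ∃ l : List (Fin m), l.length = L * n + c ∧ (l.map A).prod = evalNat n P) ∧
        ∃ i j, P i j ≠ 0 ∧ s ≤ (P i j).natDegree := by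
  by_contra! hcon
  rw [NonUnitalSubring.mem_closure_iff, Subsemigroup.closure_eq] at h
  -- Polynomial words are closed under products, so the subring is their additive span; if all had
  -- entries of degree below `s`, so would every element.
  have hlow : ∃ P : Matrix (Fin d) (Fin d) ℂ[X],
      (∀ n : ℕ, ((n : ℂ) + 1) ^ s • W = evalNat n P) ∧ ∀ i j, P i j ∈ degreeLT ℂ s := by
    refine AddSubgroup.closure_induction (p := fun f _ => ∃ P : Matrix (Fin d) (Fin d) ℂ[X],
      (∀ n : ℕ, f n = evalNat n P) ∧ ∀ i j, P i j ∈ degreeLT ℂ s) ?_ ?_ ?_ ?_ h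
    · rintro f ⟨L, hL, ⟨c, hf⟩, P, hP⟩
      refine ⟨P, hP, fun i j => ?_⟩
      by_cases h0 : P i j = 0
      · rw [h0]; exact zero_mem _
      · have := hcon L c hL P (fun n => (hP n) ▸ hf n) i j h0
        rw [mem_degreeLT, degree_eq_natDegree h0]
        exact_mod_cast this
    · exact ⟨0, fun n => by simp, fun i j => zero_mem _⟩
    · rintro f g _ _ ⟨P, hP, hP'⟩ ⟨Q, hQ, hQ'⟩
      exact ⟨P + Q, fun n => by rw [Pi.add_apply, hP, hQ, map_add],
        fun i j => add_mem (hP' i j) (hQ' i j)⟩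
    · rintro f _ ⟨P, hP, hP'⟩
      exact ⟨-P, fun n => by rw [Pi.neg_apply, hP, map_neg], fun i j => neg_mem (hP' i j)⟩
  obtain ⟨P, hP, hdeg⟩ := hlow
  obtain ⟨i, j, hij⟩ : ∃ i j, W i j ≠ 0 := by
    by_contra! h0
    exact hW (Matrix.ext h0)
  have heq : P i j = C (W i j) * (X + C 1) ^ s := by
    refine eq_of_infinite_eval_eq _ _ ((Set.infinite_range_of_injective
      (Nat.cast_injective (R := ℂ))).mono ?_)
    rintro _ ⟨n, rfl⟩
    have := congrFun (congrFun (hP n) i) j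
    rw [evalNat_apply, Matrix.smul_apply, smul_eq_mul] at this
    simp only [Set.mem_ofPred_eq, eval_mul, eval_C, eval_pow, eval_add, eval_X]
    rw [← this, mul_comm]
  have h1 := mem_degreeLT.1 (hdeg i j)
  rw [heq, degree_C_mul hij, degree_pow, degree_X_add_C] at h1
  simp at h1

end Polynomial

/-! ### The lower bound. -/

section LowerBound

variable {d m : ℕ} {N : Seminorm ℂ (Matrix (Fin d) (Fin d) ℂ)}
  {A : Fin m → Matrix (Fin d) (Fin d) ℂ}

/-- A polynomial lower bound for `maxNorm` along an arithmetic progression extends to all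
lengths. -/
theorem exists_mul_pow_le_maxNorm_of_eventually (hm : 0 < m) (hN : ∀ X, N X = 0 → X = 0)
    {L c s : ℕ} (hL : 1 ≤ L) {c₀ : ℝ} (hc₀ : 0 < c₀)
    (h : ∀ᶠ n : ℕ in atTop, c₀ * (n : ℝ) ^ s ≤ maxNorm N A (L * n + c)) :
    ∃ C : ℝ, 0 < C ∧ ∀ n : ℕ, C * (n : ℝ) ^ s ≤ maxNorm N A n := by
  obtain ⟨n₀, hn₀⟩ := eventually_atTop.1 h
  obtain ⟨C, hC0, hC⟩ := exists_seminorm_mul_le N hN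
  have hB : 0 ≤ ∑ r ∈ Finset.range (L + L * n₀ + c + 1), maxNorm N A r :=
    Finset.sum_nonneg fun r _ => maxNorm_nonneg N A r
  set B := ∑ r ∈ Finset.range (L + L * n₀ + c + 1), maxNorm N A r with hBdef
  have hL0 : (0 : ℝ) < L := by exact_mod_cast hL
  refine ⟨c₀ / ((L : ℝ) ^ s * (C * (B + 1))), by positivity, fun n => ?_⟩
  -- This gives n ≤ L n' and n' ≥ n₀, while L n' + c exceeds n by a bounded amount, whose maximal
  -- norm is at most `B`.
  set n' := n / L + 1 + n₀ with hn'
  have hdiv := Nat.div_add_mod n L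
  have hmod := Nat.mod_lt n hL
  have hlen : L * n' + c = n + (L - n % L + L * n₀ + c) := by
    rw [hn', mul_add, mul_add, mul_one]
    omega
  have h1 := hn₀ n' (Nat.le_add_left _ _)
  rw [hlen] at h1
  have h2 := maxNorm_add_le (A := A) hm hC hC0 n (L - n % L + L * n₀ + c)
  have h3 : maxNorm N A (L - n % L + L * n₀ + c) ≤ B :=
    Finset.single_le_sum (f := fun r => maxNorm N A r) (fun r _ => maxNorm_nonneg N A r)
      (Finset.mem_range.2 (by omega))
  have h4 : (n : ℝ) ≤ L * n' := by
    have : n ≤ L * n' := by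
      rw [hn', mul_add, mul_add, mul_one]
      omega
    exact_mod_cast this
  have hn0 := maxNorm_nonneg N A n
  rw [div_mul_eq_mul_div, div_le_iff₀ (by positivity)]
  calc c₀ * (n : ℝ) ^ s ≤ c₀ * (L * n') ^ s := by gcongr
    _ = L ^ s * (c₀ * (n' : ℝ) ^ s) := by rw [mul_pow]; ring
    _ ≤ L ^ s * (C * maxNorm N A n * (B + 1)) := by
        refine mul_le_mul_of_nonneg_left (h1.trans (h2.trans ?_)) (by positivity)
        exact mul_le_mul_of_nonneg_left (by linarith) (mul_nonneg hC0.le hn0)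
    _ = _ := by ring

/-- If the semigroup is finite, then the maximal norms are bounded below. -/
theorem exists_le_maxNorm_of_finiteModulo_bot (hN : ∀ X, N X = 0 → X = 0)
    (hA : NonDegenerate N A) (hfin : FiniteModulo (semigroup A) ⊥) :
    ∃ C : ℝ, 0 < C ∧ ∀ n : ℕ, C ≤ maxNorm N A n := by
  obtain ⟨T, hT, -, hr⟩ := hfin
  have hST : ∀ s ∈ semigroup A, s ∈ T := fun s hs => by
    obtain ⟨r, hrT, hsr⟩ := hr s hs
    rwa [sub_eq_zero.1 ((Submodule.mem_bot ℂ).1 hsr)]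
  have hfinite : (Set.range fun n => maxNorm N A n).Finite := by
    refine (hT.image N).subset ?_
    rintro _ ⟨n, rfl⟩
    obtain ⟨l, -, hl⟩ := exists_maxNorm_eq N A hA.pos n
    exact ⟨_, hST _ (list_map_prod_mem (S := semigroup A) (A := A) (fun i => Submonoid.subset_closure ⟨i, rfl⟩) l), hl⟩
  obtain ⟨_, ⟨n₀, rfl⟩, hmin⟩ := Set.exists_min_image _ id hfinite (Set.range_nonempty _)
  exact ⟨_, hA.maxNorm_pos hN n₀, fun n => hmin _ ⟨n, rfl⟩⟩

/-- If no power identity with `s ≥ 1` factors holds but one with `s + 1` factors does, then the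
maximal norms grow at least like `n ^ s`. -/
theorem exists_mul_pow_le_maxNorm (hm : 0 < m) (hN : ∀ X, N X = 0 → X = 0) {s : ℕ} (hs : 1 ≤ s)
    (hnot : ¬ SatisfiesIdentity A s) {a : ℕ} (ha : 0 < a)
    (hJ : torsionIdeal (semigroup A) a ^ (s + 1) = ⊥) :
    ∃ C : ℝ, 0 < C ∧ ∀ n : ℕ, C * (n : ℝ) ^ s ≤ maxNorm N A n := by
  -- This exponent serves twice: the factor 2 gives linear growth modulo J^2, and the factor s + 1
  -- gives z(z - 1)^(s+1) = 0 for z = X^b, hence polynomial entries. The identity fails for every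
  -- exponent, so in particular for `b`.
  set b := a * (2 * (s + 1)) with hb
  have hb0 : 0 < b := by positivity
  obtain ⟨X, Y, hX, hY, hW⟩ : ∃ X Y : Fin s → Matrix (Fin d) (Fin d) ℂ,
      (∀ i, X i ∈ semigroup A) ∧ (∀ i, Y i ∈ semigroup A) ∧
      (List.ofFn fun i => (X i ^ (2 * b) - X i ^ b) * Y i).prod ≠ 0 := by
    by_contra! hcon
    exact hnot ⟨b, hb0, hcon⟩
  have hnil : ∀ i, X i ^ b * (X i ^ b - 1) ^ (s + 1) = 0 := fun i => by
    have h := pow_mul_sub_one_pow_mem (a := a) (hX i) (j := s + 1) (c := 2) two_pos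
    rwa [hJ, Submodule.mem_bot, mul_comm (s + 1) 2, ← hb] at h
  have hmem : (fun n : ℕ => ((n : ℂ) + 1) ^ s •
      (List.ofFn fun i => (X i ^ (2 * b) - X i ^ b) * Y i).prod) ∈
      NonUnitalSubring.closure (polynomialWords A : Set (ℕ → Matrix (Fin d) (Fin d) ℂ)) := by
    have h := list_prod_mem_of_ne_nil _ (l := List.ofFn fun (i : Fin s) (n : ℕ) =>
      ((X i ^ b) ^ (n + 1) * (X i ^ b) ^ (n + 1) - (X i ^ b) ^ (n + 1)) * Y i)
      (by rw [Ne, List.ofFn_eq_nil_iff]; omega) (fun f hf => by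
        obtain ⟨i, rfl⟩ := List.mem_ofFn.1 hf
        exact pow_sub_pow_mul_mem_closure (hX i) (hY i) hb0 (hnil i))
    convert h using 1
    ext1 n
    rw [← prod_pow_sub_pow_eq_smul hJ hb s.succ_pos X Y hX hY n]
    have := map_list_prod (Pi.evalRingHom (fun _ : ℕ => Matrix (Fin d) (Fin d) ℂ) n)
      (List.ofFn fun (i : Fin s) (n : ℕ) =>
        ((X i ^ b) ^ (n + 1) * (X i ^ b) ^ (n + 1) - (X i ^ b) ^ (n + 1)) * Y i)
    rw [List.map_ofFn] at this
    exact this.symm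
  obtain ⟨L, c, hL, P, hP, i, j, hne, hdeg⟩ := exists_natDegree_le_of_mem_closure hW hmem
  obtain ⟨c₀, hc₀, hev⟩ := exists_mul_pow_le_norm_eval s (P i j) hne hdeg
  obtain ⟨K, hK0, hK⟩ := exists_norm_entry_le N hN
  refine exists_mul_pow_le_maxNorm_of_eventually (c := c) hm hN hL (c₀ := c₀ / K) (by positivity) ?_
  filter_upwards [hev] with n hn
  obtain ⟨l, hl, hlP⟩ := hP n
  have h1 := le_maxNorm N A l
  rw [hl, hlP] at h1
  rw [div_mul_eq_mul_div, div_le_iff₀ hK0]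
  calc c₀ * (n : ℝ) ^ s ≤ ‖(P i j).eval (n : ℂ)‖ := hn
    _ ≤ K * N (evalNat n P) := hK (evalNat n P) i j
    _ ≤ K * maxNorm N A (L * n + c) := by gcongr
    _ = _ := mul_comm _ _

end LowerBound

end MatrixGrowth

/-! ### The main theorem. -/

theorem theorem2p7 {d m : ℕ} (N : Seminorm ℂ (Matrix (Fin d) (Fin d) ℂ))
    (hN : ∀ X : Matrix (Fin d) (Fin d) ℂ, N X = 0 → X = 0)
    (A : Fin m → Matrix (Fin d) (Fin d) ℂ)
    (hA : MatrixGrowth.NonDegenerate N A)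
    (htame : ∀ X ∈ MatrixGrowth.semigroup A, MatrixGrowth.IsTame X) :
    ∃ k : ℕ, IsLeast {j : ℕ | MatrixGrowth.SatisfiesIdentity A j} k ∧ 1 ≤ k ∧
      ∃ C₁ C₂ : ℝ, 0 < C₁ ∧ 0 < C₂ ∧ ∀ n : ℕ, 1 ≤ n →
        C₁ * (n : ℝ) ^ (k - 1) ≤ MatrixGrowth.maxNorm N A n ∧
          MatrixGrowth.maxNorm N A n ≤ C₂ * (n : ℝ) ^ (k - 1) := by
  classical
  open MatrixGrowth in
  have hex := exists_satisfiesIdentity htame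
  obtain ⟨k, hk, hmin⟩ : ∃ k, SatisfiesIdentity A k ∧ ∀ j < k, ¬ SatisfiesIdentity A j :=
    ⟨Nat.find hex, Nat.find_spec hex, fun j hj => Nat.find_min hex hj⟩
  obtain ⟨a, ha, hJ⟩ := (satisfiesIdentity_iff k).1 hk
  have hfin := finiteModulo_torsionIdeal htame ha
  have hk1 : 1 ≤ k := by
    by_contra h
    obtain rfl : k = 0 := by omega
    obtain ⟨_, -, h0⟩ := hk
    exact hA.one_ne_zero hN (by
      simpa using h0 Fin.elim0 Fin.elim0 (fun i => i.elim0) fun i => i.elim0)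
  have hlower : ∃ C₁ : ℝ, 0 < C₁ ∧ ∀ n : ℕ, C₁ * (n : ℝ) ^ (k - 1) ≤ maxNorm N A n := by
    obtain ⟨s, rfl⟩ : ∃ s, k = s + 1 := ⟨k - 1, by omega⟩
    rcases Nat.eq_zero_or_pos s with rfl | hs
    -- For k = 1 the torsion ideal itself is zero, so the semigroup is finite; the expansion
    -- argument needs at least one factor.
    · rw [zero_add, pow_one] at hJ
      rw [hJ] at hfin
      simpa using exists_le_maxNorm_of_finiteModulo_bot hN hA hfin
    · exact exists_mul_pow_le_maxNorm hA.pos hN hs (hmin s (Nat.lt_succ_self s)) ha hJ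
  obtain ⟨C₁, hC₁, h₁⟩ := hlower
  obtain ⟨C₂, hC₂, h₂⟩ := exists_maxNorm_le (N := N) hA.pos hJ hfin
  exact ⟨k, ⟨hk, fun j hj => not_lt.1 fun hjk => hmin j hjk hj⟩, hk1, C₁, C₂, hC₁, hC₂,
    fun n hn => ⟨h₁ n, h₂ n hn⟩⟩
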